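/- All compact spaces are Hausdorff, $\omega$ carries the discrete topology, and $C(L)$ is the Banach space of real-valued continuous functions on a compact space $L$ with the supremum norm. A compactification of $\omega$ is a compact space $L$ containing $\omega$ as a dense subspace; $L\setminus\omega$ is its growth. A space $K$ supports a measure if there is a finite Radon measure $\mu$ on $K$ with $\mu(U)>0$ for every nonempty open $U\subseteq K$. The natural copy of $c_0$ in $C(L)$ is the subspace $\{f\in C(L)\colon f(x)=0 \text{ for all } x\in L\setminus\omega\}$. A closed subspace $Y$ of a Banach space $X$ is complemented in $X$ if there is a bounded linear projection of $X$ onto $Y$. A Banach space $X$ is hereditarily separably Sobczyk if every subspace of $X$ isomorphic to $c_0$ contains a further subspace isomorphic to $c_0$ which is complemented in $X$. Let $\mathcal{N}$ and $\mathcal{M}$ be the ideals of Lebesgue null and of meager subsets of $\mathbb{R}$, let $\mathrm{add}(\mathcal{N})$ be the least cardinality of a family of sets in $\mathcal{N}$ whose union is not in $\mathcal{N}$, and let $\mathrm{non}(\mathcal{M})$ be the least cardinality of a subset of $\mathbb{R}$ that is not in $\mathcal{M}$. **Corollary.** There is a compactification $L$ of $\omega$ such that 1. $L\setminus\omega$ is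 non-separable and supports a measure, and 2. the natural copy of $c_0$ is complemented in $C(L)$. If $\mathrm{add}(\mathcal{N})=\mathrm{non}(\mathcal{M})$, then there is a compactification $L$ of $\omega$ with properties 1 and 2 such that, in addition, $L\setminus\omega$ does not map continuously onto $[0,1]^{\omega_1}$ and $C(L)$ is hereditarily separably Sobczyk. -/

import Mathlib

open MeasureTheory Topology Cardinal Ordinal ZeroAtInfty

namespace OmegaCompactification

noncomputable section

/-- The additivity of a family `I` of subsets of `K` (in practice an ideal): the least cardinality
of a subfamily of `I` whose union is not in `I`. -/
def additivity {K : Type} (I : Set (Set K)) : Cardinal.{0} :=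
  sInf {κ | ∃ A : Set (Set K), A ⊆ I ∧ ⋃₀ A ∉ I ∧ #A = κ}

/-- The uniformity of a family `I` of subsets of `K` (in practice an ideal): the least cardinality
of a subset of `K` that is not in `I`. -/
def uniformity {K : Type} (I : Set (Set K)) : Cardinal.{0} :=
  sInf {κ | ∃ X : Set K, X ∉ I ∧ #X = κ}

/-- The ideal of Lebesgue null sets of reals. -/
def nullIdeal : Set (Set ℝ) := {s | volume s = 0}

/-- The ideal of meagre sets of reals. -/
def meagreIdeal : Set (Set ℝ) := {s | IsMeagre s}

/-- `X` supports a measure: there is a finite Radon (regular Borel) measure on `X` that is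
positive on every nonempty open set. -/
def SupportsMeasure (X : Type) [TopologicalSpace X] : Prop :=
  letI : MeasurableSpace X := borel X
  ∃ μ : Measure X, IsFiniteMeasure μ ∧ μ.Regular ∧ ∀ U : Set X, IsOpen U → U.Nonempty → 0 < μ U

/-- `X` maps continuously onto the Tychonoff cube `[0,1]^{ω₁}`. -/
def MapsOntoCube (X : Type) [TopologicalSpace X] : Prop :=
  ∃ f : X → ((ω₁ : Ordinal.{0}).ToType → unitInterval), Continuous f ∧ Function.Surjective f

/-- The growth (remainder) `L ∖ ω` of a compactification `e : ω → L`. -/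
def growth {L : Type} (e : ℕ → L) : Set L := (Set.range e)ᶜ

/-- The natural copy of `c₀` in `C(L)`: the continuous functions that vanish on the growth. -/
def naturalCopy {L : Type} [TopologicalSpace L] (e : ℕ → L) : Submodule ℝ C(L, ℝ) where
  carrier := {f | ∀ x ∈ growth e, f x = 0}
  add_mem' {f g} hf hg x hx := by simp [hf x hx, hg x hx]
  zero_mem' x _ := rfl
  smul_mem' c f hf x hx := by simp [hf x hx]

/-- The subspace `Y` is an isomorphic copy of `c₀` (the null sequences with the supremum norm). -/
def IsCopyOfC0 {X : Type} [NormedAddCommGroup X] [NormedSpace ℝ X] (Y : Submodule ℝ X) : Prop :=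
  Nonempty (C₀(ℕ, ℝ) ≃L[ℝ] Y)

/-- `X` is hereditarily separably Sobczyk: every isomorphic copy of `c₀` in `X` contains a further
copy of `c₀` that is complemented in `X`. -/
def HereditarilySeparablySobczyk (X : Type) [NormedAddCommGroup X] [NormedSpace ℝ X] : Prop :=
  ∀ Y : Submodule ℝ X, IsCopyOfC0 Y →
    ∃ Z : Submodule ℝ X, Z ≤ Y ∧ IsCopyOfC0 Z ∧ Z.ClosedComplemented

end

end OmegaCompactification

namespace OmegaCompactification

open Filter

/-! ### Slaloms -/

/-! Compactify the countable tree of nodes so that continuous functions are generated by single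
nodes, by digits, and by the sets of nodes that avoid a slalom from some coordinate on. Every branch
converges to a point of the growth, so averaging over a random branch through a node `s` gives a
functional on `C(L)`. If the slaloms are thin, a random continuation of a long node rarely changes
an avoidance label, hence `f(s)` minus its average tends to zero (`tendsto_meanOsc`). This
difference is the projection onto the natural copy of `c₀` (`closedComplemented_naturalCopy`), and a
weighted sum of the averages gives a strictly positive measure on the growth
(`supportsMeasure_growth`). A hitting family makes the growth non-separable
(`not_separableSpace_growth`). The family of all thin slaloms is hitting, which settles the
unconditional half.

If add(N) = non(M), there is a hitting family that is a well-ordered chain under almost inclusion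
(`exists_hitting_chain`): fewer than add(N) thin slaloms have a thin bound, and capturing a
nonmeagre set suffices for hitting. Along a chain the avoidance labels are monotone. A least-element
argument then makes `L` sequentially compact (`seqCompactSpace_of_chain`), and a convergent sequence
of points yields complemented copies of `c₀`. Monotonicity also makes the L¹-seminorm of every
positive functional separable (`exists_countable_dense_of_chain`), whereas a map of the growth onto
the cube would produce `ω₁` functions at mutual distance 1/2. -/

/-- The points of the product of the finite sets `Fin (2 ^ n)`. -/
abbrev Branch : Type := ∀ n : ℕ, Fin (2 ^ n)

/-- A slalom: a finite set of candidate values at every coordinate. -/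
abbrev Slalom : Type := ∀ n : ℕ, Finset (Fin (2 ^ n))

/-- A slalom is thin if the densities of its sections are summable. -/
def Slalom.Thin (S : Slalom) : Prop := Summable fun n => ((S n).card : ℝ) / 2 ^ n

/-- Inclusion of slaloms at all but finitely many coordinates. -/
def Slalom.AELe (S T : Slalom) : Prop := ∀ᶠ n in atTop, S n ⊆ T n

/-- A family of slaloms is hitting if every countable set of branches is captured infinitely often
by one of its members. -/
def Hitting (F : Set Slalom) : Prop :=
  ∀ x : ℕ → Branch, ∃ S ∈ F, ∀ k, ∃ᶠ n in atTop, x k n ∈ S n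

theorem Slalom.AELe.trans {S T U : Slalom} (h : S.AELe T) (h' : T.AELe U) : S.AELe U := by
  filter_upwards [h, h'] with n h1 h2 using h1.trans h2

theorem Slalom.Thin.union {S T : Slalom} (hS : S.Thin) (hT : T.Thin) :
    Slalom.Thin (fun n => S n ∪ T n) := by
  refine Summable.of_nonneg_of_le (fun n => by positivity) (fun n => ?_) (hS.add hT)
  rw [← add_div]
  gcongr
  exact_mod_cast Finset.card_union_le _ _

theorem Slalom.thin_of_card_le {S : Slalom}
    (h : ∀ n, (S n).card ≤ n + 1) : S.Thin := by
  have h1 : Summable fun n : ℕ => ((n : ℝ) + 1) / 2 ^ n := by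
    have h2 := summable_pow_mul_geometric_of_norm_lt_one 1 (r := (1 / 2 : ℝ)) (by norm_num)
    have h3 := summable_geometric_of_lt_one (r := (1 / 2 : ℝ)) (by norm_num) (by norm_num)
    refine (h2.add h3).congr fun n => ?_
    simp only [one_div, inv_pow]
    field_simp
  refine Summable.of_nonneg_of_le (fun n => by positivity) (fun n => ?_) h1
  gcongr
  exact_mod_cast h n

/-- Diagonalise: at coordinate `n` collect the values of the first `n + 1` branches. The densities
`(n + 1) / 2 ^ n` are summable. -/
theorem hitting_setOf_thin : Hitting {S | S.Thin} := by
  intro x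
  refine ⟨fun n => (Finset.range (n + 1)).image fun k => x k n,
    Slalom.thin_of_card_le fun n => ?_, fun k => ?_⟩
  · simpa using Finset.card_image_le (s := Finset.range (n + 1)) (f := fun k => x k n)
  · refine Eventually.frequently ?_
    filter_upwards [eventually_ge_atTop k] with n hn
    exact Finset.mem_image_of_mem _ (Finset.mem_range.2 (by omega))

/-- Countably many thin slaloms have a thin almost upper bound. -/
theorem exists_thin_bound_of_countable {ι : Type*} [Countable ι] (T : ι → Slalom)
    (hT : ∀ i, (T i).Thin) : ∃ U : Slalom, U.Thin ∧ ∀ i, (T i).AELe U := by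
  rcases isEmpty_or_nonempty ι with hι | hι
  · exact ⟨fun _ => ∅, by simp [Slalom.Thin], fun i => isEmptyElim i⟩
  obtain ⟨e, he⟩ := exists_surjective_nat ι
  -- Cut the `j`-th slalom off so late that its remaining densities sum to at most `2⁻ʲ`; the union
  -- of all the truncated slaloms is then thin.
  have key : ∀ j, ∃ m : ℕ, ∑' n, (if m ≤ n then ((T (e j) n).card : ℝ) / 2 ^ n else 0)
      ≤ (1 / 2) ^ j := by
    intro j
    have h1 := tendsto_sum_nat_add fun n => ((T (e j) n).card : ℝ) / 2 ^ n
    obtain ⟨m, hm⟩ := (h1.eventually_lt_const (by positivity : (0 : ℝ) < (1 / 2) ^ j)).exists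
    refine ⟨m, le_trans (le_of_eq ?_) hm.le⟩
    have hs : Summable fun n => (if m ≤ n then ((T (e j) n).card : ℝ) / 2 ^ n else 0) :=
      Summable.of_nonneg_of_le (fun n => by split_ifs <;> positivity)
        (fun n => by split_ifs; exacts [le_rfl, by positivity]) (hT (e j))
    rw [← hs.sum_add_tsum_nat_add m, Finset.sum_eq_zero, zero_add]
    · exact tsum_congr fun n => by simp
    · intro n hn
      rw [if_neg (by simpa using hn)]
  choose m hm using key
  set g : ℕ → ℕ → ℝ := fun j n => if m j ≤ n then ((T (e j) n).card : ℝ) / 2 ^ n else 0 with hg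
  have g0 : ∀ j n, 0 ≤ g j n := fun j n => by simp only [hg]; split_ifs <;> positivity
  have hgs : Summable fun p : ℕ × ℕ => g p.1 p.2 := by
    rw [summable_prod_of_nonneg (fun p => g0 _ _)]
    refine ⟨fun j => Summable.of_nonneg_of_le (g0 j) (fun n => ?_) (hT (e j)), ?_⟩
    · simp only [hg]; split_ifs; exacts [le_rfl, by positivity]
    · exact Summable.of_nonneg_of_le (fun j => tsum_nonneg (g0 j)) hm
        (summable_geometric_of_lt_one (by norm_num) (by norm_num))
  have hgs' : Summable fun p : ℕ × ℕ => g p.2 p.1 := hgs.prod_symm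
  refine ⟨fun n => ((Finset.range (n + 1)).filter fun j => m j ≤ n).biUnion fun j => T (e j) n,
    ?_, fun i => ?_⟩
  · refine Summable.of_nonneg_of_le (fun n => by positivity) (fun n => ?_) hgs'.prod
    calc _ ≤ (∑ j ∈ (Finset.range (n + 1)).filter (fun j => m j ≤ n),
            ((T (e j) n).card : ℝ)) / 2 ^ n := by
          gcongr
          exact_mod_cast Finset.card_biUnion_le
      _ = ∑ j ∈ Finset.range (n + 1), g j n := by
          rw [Finset.sum_div, Finset.sum_filter]
      _ ≤ _ := (hgs'.prod_factor n).sum_le_tsum _ fun j _ => g0 j n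
  · obtain ⟨j, rfl⟩ := he i
    filter_upwards [eventually_ge_atTop j, eventually_ge_atTop (m j)] with n h1 h2
    exact Finset.subset_biUnion_of_mem (fun j => T (e j) n)
      (Finset.mem_filter.2 ⟨Finset.mem_range.2 (by omega), h2⟩)

/-! ### The uniform measure on branches -/

/-- The product of the uniform probability measures. -/
noncomputable def branchMeasure : Measure Branch :=
  Measure.infinitePi fun n => (ProbabilityTheory.uniformOn Set.univ : Measure (Fin (2 ^ n)))

instance uniformOn_univ_fin_isProbabilityMeasure (n : ℕ) :
    IsProbabilityMeasure (ProbabilityTheory.uniformOn Set.univ : Measure (Fin (2 ^ n))) :=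
  ProbabilityTheory.isProbabilityMeasure_uniformOn Set.finite_univ Set.univ_nonempty

instance : IsProbabilityMeasure branchMeasure := by
  unfold branchMeasure; infer_instance

theorem uniformOn_univ_finset (n : ℕ) (s : Finset (Fin (2 ^ n))) :
    (ProbabilityTheory.uniformOn Set.univ : Measure (Fin (2 ^ n))) s =
      ENNReal.ofReal ((s.card : ℝ) / 2 ^ n) := by
  rw [ProbabilityTheory.uniformOn_univ, Measure.count_apply_finset, Fintype.card_fin,
    ENNReal.ofReal_div_of_pos (by positivity)]
  simp [ENNReal.ofReal_pow]

theorem branchMeasure_coord (n : ℕ) (s : Finset (Fin (2 ^ n))) :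
    branchMeasure {x | x n ∈ s} = ENNReal.ofReal ((s.card : ℝ) / 2 ^ n) := by
  have h := Measure.infinitePi_pi
    (fun n => (ProbabilityTheory.uniformOn Set.univ : Measure (Fin (2 ^ n))))
    (s := {n}) (t := fun k => {i | ∀ h : k = n, h ▸ i ∈ s}) (fun _ _ => by measurability)
  rw [Finset.prod_singleton] at h
  have h2 : {i : Fin (2 ^ n) | ∀ h : n = n, h ▸ i ∈ s} = (s : Set (Fin (2 ^ n))) := by
    ext i; simp
  rw [h2, uniformOn_univ_finset] at h
  rw [← h, branchMeasure]
  congr 1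
  ext x
  simp

/-- By independence the avoiding set has measure at most `∏ (1 - dₙ) ≤ exp (-∑ dₙ)`, with `dₙ` the
densities. A positive measure therefore bounds their partial sums. -/
theorem Slalom.Thin.of_branchMeasure_pos {T : Slalom}
    (h : 0 < branchMeasure {x | ∀ n, x n ∉ T n}) : T.Thin := by
  set c := branchMeasure {x | ∀ n, x n ∉ T n} with hc
  have hle : ∀ k, c ≤ ENNReal.ofReal (∏ n ∈ Finset.range k, (1 - ((T n).card : ℝ) / 2 ^ n)) := by
    intro k
    have h1 := Measure.infinitePi_pi
      (fun n => (ProbabilityTheory.uniformOn Set.univ : Measure (Fin (2 ^ n))))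
      (s := Finset.range k) (t := fun n => (↑(T n)ᶜ : Set (Fin (2 ^ n))))
      (fun _ _ => by measurability)
    have h2 : c ≤ branchMeasure (Set.pi (Finset.range k)
        fun n => (↑(T n)ᶜ : Set (Fin (2 ^ n)))) := by
      refine measure_mono fun x hx n _ => ?_
      simpa using hx n
    refine h2.trans (le_of_eq ?_)
    have hcard : ∀ n, (((T n)ᶜ.card : ℝ)) / 2 ^ n = 1 - ((T n).card : ℝ) / 2 ^ n := by
      intro n
      rw [Finset.card_compl, Nat.cast_sub (by simpa using Finset.card_le_univ (T n))]
      simp [sub_div]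
    rw [branchMeasure, h1, ENNReal.ofReal_prod_of_nonneg]
    · refine Finset.prod_congr rfl fun n _ => ?_
      rw [uniformOn_univ_finset, hcard]
    · intro n _
      rw [← hcard]; positivity
  have hctop : c ≠ ⊤ := measure_ne_top _ _
  have hc0 : 0 < c.toReal := ENNReal.toReal_pos h.ne' hctop
  refine summable_of_sum_range_le (c := - Real.log c.toReal) (fun n => by positivity) fun k => ?_
  have h1 : c.toReal ≤ Real.exp (-∑ n ∈ Finset.range k, ((T n).card : ℝ) / 2 ^ n) := by
    have hnn : ∀ n ∈ Finset.range k, 0 ≤ 1 - ((T n).card : ℝ) / 2 ^ n := by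
      intro n _
      rw [sub_nonneg, div_le_one (by positivity)]
      exact_mod_cast by simpa using Finset.card_le_univ (T n)
    refine (ENNReal.toReal_le_of_le_ofReal (Finset.prod_nonneg hnn) (hle k)).trans ?_
    rw [← Finset.sum_neg_distrib, Real.exp_sum]
    refine Finset.prod_le_prod hnn fun n _ => ?_
    have := Real.add_one_le_exp (-(((T n).card : ℝ) / 2 ^ n))
    linarith
  have h2 := (Real.log_le_log hc0 h1)
  rw [Real.log_exp] at h2
  linarith

/-! ### Bounding few slaloms -/

/-- If the branches captured infinitely often by members of `A` form a null set, then `A` has a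
thin almost upper bound. -/
theorem exists_thin_bound_of_null {Ω : Type*} [TopologicalSpace Ω] [PolishSpace Ω]
    [MeasurableSpace Ω] [BorelSpace Ω] (μ : Measure Ω) [IsProbabilityMeasure μ] (d : Ω → Branch)
    (hd : Continuous d) (hμ : μ.map d = branchMeasure) (A : Set Slalom)
    (hA : μ {y | ∃ S ∈ A, ∃ᶠ n in atTop, d y n ∈ S n} = 0) :
    ∃ T : Slalom, T.Thin ∧ ∀ S ∈ A, S.AELe T := by
  classical
  set U := {y | ∃ S ∈ A, ∃ᶠ n in atTop, d y n ∈ S n} with hU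
  have hE : MeasurableSet (toMeasurable μ U)ᶜ := (measurableSet_toMeasurable _ _).compl
  have hE1 : μ (toMeasurable μ U)ᶜ = 1 := by
    rw [prob_compl_eq_one_iff (measurableSet_toMeasurable _ _), measure_toMeasurable, hA]
  -- `F` is a closed set of positive measure disjoint from the null set. The support `K` of the
  -- restriction to `F` is Polish, and each nonempty relatively open part of it has positive
  -- measure.
  obtain ⟨F, hFE, hF, hF0⟩ := hE.exists_lt_isClosed_of_ne_top (measure_ne_top μ _)
    (r := 0) (by rw [hE1]; exact one_pos)
  set ν := μ.restrict F with hν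
  have hKF : ν.support ⊆ F := by
    refine Measure.support_subset_of_isClosed hF ?_
    exact ae_restrict_mem hF.measurableSet
  set K := ν.support with hK
  have hKc : IsClosed K := Measure.isClosed_support
  have : PolishSpace K := hKc.polishSpace
  have hK0 : ν Kᶜ = 0 := Measure.measure_compl_support
  have hKne : K.Nonempty := by
    rw [Set.nonempty_iff_ne_empty]
    intro h
    rw [h, Set.compl_empty, hν, Measure.restrict_apply_univ] at hK0
    exact hF0.ne' hK0
  let B := TopologicalSpace.countableBasis Ω
  -- The values that no digit sequence from `K ∩ b` takes. A set of positive measure avoids them, so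
  -- they form a thin slalom.
  let T : B → Slalom := fun b n =>
    Finset.univ.filter fun i => ∀ y ∈ K ∩ b.1, d y n ≠ i
  have hT : ∀ b : {b : B // (K ∩ b.1).Nonempty}, (T b.1).Thin := by
    rintro ⟨⟨b, hb⟩, y, hyK, hyb⟩
    have hbo : IsOpen b := TopologicalSpace.isOpen_of_mem_countableBasis hb
    have h1 : 0 < ν b := (Measure.mem_support_iff_forall y).1 hyK b (hbo.mem_nhds hyb)
    have h2 : ν b ≤ μ (K ∩ b) := by
      calc ν b ≤ ν (K ∩ b ∪ Kᶜ) := measure_mono fun z hz => by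
            by_cases h : z ∈ K
            · exact Or.inl ⟨h, hz⟩
            · exact Or.inr h
        _ ≤ ν (K ∩ b) + ν Kᶜ := measure_union_le _ _
        _ = ν (K ∩ b) := by rw [hK0, add_zero]
        _ ≤ μ (K ∩ b) := Measure.restrict_apply_le _ _
    refine Slalom.Thin.of_branchMeasure_pos (lt_of_lt_of_le h1 (h2.trans ?_))
    rw [← hμ]
    refine le_trans (measure_mono ?_) (Measure.le_map_apply hd.measurable.aemeasurable _)
    intro z hz n hn
    exact (Finset.mem_filter.1 hn).2 z hz rfl
  obtain ⟨V, hV, hTV⟩ := exists_thin_bound_of_countable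
    (fun b : {b : B // (K ∩ b.1).Nonempty} => T b.1) hT
  refine ⟨V, hV, fun S hS => ?_⟩
  have : Nonempty K := hKne.to_subtype
  -- Baire category: some closed set `C m` contains a nonempty `K ∩ b`, so from `m` on all values of
  -- `S` are among those omitted on `K ∩ b`.
  let C : ℕ → Set K := fun m => {y | ∀ n, m ≤ n → d y n ∉ S n}
  have hC : ∀ m, IsClosed (C m) := by
    intro m
    have : C m = ⋂ n, ⋂ (_ : m ≤ n), (fun y : K => d y n) ⁻¹' {i | i ∉ S n} := by
      ext y; simp [C]
    rw [this]
    refine isClosed_iInter fun n => isClosed_iInter fun _ => IsClosed.preimage ?_ ?_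
    · exact (continuous_apply n).comp (hd.comp continuous_subtype_val)
    · exact isClosed_discrete _
  have hCU : ⋃ m, C m = Set.univ := by
    rw [Set.eq_univ_iff_forall]
    intro y
    have h1 : y.1 ∉ U := fun h => hFE (hKF y.2) (subset_toMeasurable μ U h)
    have h2 : ¬ ∃ᶠ n in atTop, d y n ∈ S n := fun h => h1 ⟨S, hS, h⟩
    rw [not_frequently, eventually_atTop] at h2
    obtain ⟨m, hm⟩ := h2
    exact Set.mem_iUnion.2 ⟨m, hm⟩
  obtain ⟨m, y, hy⟩ := nonempty_interior_of_iUnion_of_closed hC hCU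
  rw [mem_interior_iff_mem_nhds, nhds_subtype_eq_comap, mem_comap] at hy
  obtain ⟨t, ht, htC⟩ := hy
  obtain ⟨b, hb, hyb, hbt⟩ := (TopologicalSpace.isBasis_countableBasis Ω).mem_nhds_iff.1 ht
  refine Slalom.AELe.trans ?_ (hTV ⟨⟨b, hb⟩, y, y.2, hyb⟩)
  filter_upwards [eventually_ge_atTop m] with n hn i hi
  refine Finset.mem_filter.2 ⟨Finset.mem_univ _, fun z hz hzi => ?_⟩
  have h3 : (⟨z, hz.1⟩ : K) ∈ C m := htC (hbt hz.2)
  exact h3 n hn (hzi ▸ hi)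

/-- Fewer than `additivity nullIdeal` thin slaloms have a thin almost upper bound. -/
theorem exists_thin_bound (A : Set Slalom) (hA : ∀ S ∈ A, S.Thin)
    (hcard : #A < additivity nullIdeal) : ∃ T : Slalom, T.Thin ∧ ∀ S ∈ A, S.AELe T := by
  obtain ⟨d, hd, hdμ⟩ := branchMeasure.exists_measurable_map_eq
  -- Borel–Cantelli, with thinness as the summability hypothesis.
  have hnull : ∀ S ∈ A, (volume : Measure unitInterval) {y | ∃ᶠ n in atTop, d y n ∈ S n} = 0 := by
    intro S hS
    refine measure_setOfPred_frequently_eq_zero (p := fun n y => d y n ∈ S n) ?_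
    have h1 : ∀ n, (volume : Measure unitInterval) {y | d y n ∈ S n} =
        ENNReal.ofReal (((S n).card : ℝ) / 2 ^ n) := by
      intro n
      rw [← branchMeasure_coord, ← hdμ, Measure.map_apply hd]
      · rfl
      · exact measurable_pi_apply n (MeasurableSet.of_discrete (s := (S n : Set (Fin (2 ^ n)))))
    simp_rw [h1]
    exact (hA S hS).tsum_ofReal_ne_top
  have hU : (volume : Measure unitInterval)
      {y | ∃ S ∈ A, ∃ᶠ n in atTop, d y n ∈ S n} = 0 := by
    let f : Slalom → Set ℝ := fun S => Subtype.val '' {y | ∃ᶠ n in atTop, d y n ∈ S n}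
    have h1 : f '' A ⊆ nullIdeal := by
      rintro _ ⟨S, hS, rfl⟩
      show volume _ = 0
      rw [← unitInterval.volume_apply, hnull S hS]
    have h2 : ⋃₀ (f '' A) ∈ nullIdeal := by
      by_contra h
      exact notMem_of_lt_csInf' (mk_image_le.trans_lt hcard) ⟨f '' A, h1, h, rfl⟩
    rw [unitInterval.volume_apply]
    refine measure_mono_null ?_ h2
    rintro _ ⟨y, ⟨S, hS, hy⟩, rfl⟩
    exact ⟨f S, ⟨S, hS, rfl⟩, y, hy, rfl⟩
  have hI : PolishSpace unitInterval := inferInstance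
  -- `d` is only measurable; a finer Polish topology with the same Borel sets makes it continuous.
  obtain ⟨t', ht', hc, hp⟩ := hd.exists_continuous
  refine @exists_thin_bound_of_null unitInterval t' hp _ ⟨?_⟩ volume _ d hc hdμ A hU
  have hb := @BorelSpace.measurable_eq unitInterval instTopologicalSpaceSubtype _ _
  exact hb.trans (borel_eq_borel_of_le hp hI ht').symm

/-! ### Nonmeagre families -/

/-- A map from the reals to branches whose digits change ever more rapidly. -/
noncomputable def rapidDigits (y : ℝ) : Branch :=
  fun n => ⟨(⌊y * 4 ^ n⌋ % 2 ^ n).toNat, by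
    have h1 : (0 : ℤ) < 2 ^ n := by positivity
    have h2 := Int.emod_lt_of_pos ⌊y * 4 ^ n⌋ h1
    zify
    rw [Int.toNat_of_nonneg (Int.emod_nonneg _ h1.ne')]
    exact h2⟩

/-- The `n`-th digit runs through all its values on every interval `[p / 2 ^ n, (p + 1) / 2 ^ n)`,
so prescribing it at some late `n` holds on a dense open set. -/
theorem rapidDigits_frequently_mem_residual (x : Branch) :
    {y : ℝ | ∃ᶠ n in atTop, rapidDigits y n = x n} ∈ residual ℝ := by
  have hset : {y : ℝ | ∃ᶠ n in atTop, rapidDigits y n = x n} =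
      ⋂ m : ℕ, {y | ∃ n, m ≤ n ∧ rapidDigits y n = x n} := by
    ext y; simp [frequently_atTop]
  rw [hset, countable_iInter_mem]
  intro m
  let O : Set ℝ := ⋃ n : ℕ, ⋃ (_ : m ≤ n), ⋃ p : ℤ,
    Set.Ioo ((2 ^ n * p + (x n : ℕ)) / 4 ^ n) ((2 ^ n * p + (x n : ℕ) + 1) / 4 ^ n)
  have hO : IsOpen O := isOpen_iUnion fun n => isOpen_iUnion fun _ => isOpen_iUnion fun p =>
    isOpen_Ioo
  have hOd : Dense O := by
    rw [Metric.dense_iff]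
    intro y r hr
    obtain ⟨n, hn, hmn⟩ : ∃ n : ℕ, (1 / 2 : ℝ) ^ n < r ∧ m ≤ n := by
      have h1 := tendsto_pow_atTop_nhds_zero_of_lt_one (r := (1 / 2 : ℝ)) (by norm_num)
        (by norm_num)
      exact ((h1.eventually_lt_const hr).and (eventually_ge_atTop m)).exists
    set p := ⌊y * 2 ^ n⌋ with hp
    have hp1 : (p : ℝ) ≤ y * 2 ^ n := Int.floor_le _
    have hp2 : y * 2 ^ n < p + 1 := Int.lt_floor_add_one _
    have hx : ((x n : ℕ) : ℝ) + 1 ≤ 2 ^ n := by exact_mod_cast (x n).2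
    have hx0 : (0 : ℝ) ≤ ((x n : ℕ) : ℝ) := by positivity
    have h2 : (0 : ℝ) < 2 ^ n := by positivity
    have h4 : (4 : ℝ) ^ n = 2 ^ n * 2 ^ n := by rw [← mul_pow]; norm_num
    -- The midpoint of the interval with digit `x n` inside the block of length `2⁻ⁿ` that contains
    -- `y`.
    refine ⟨(2 ^ n * p + (x n : ℕ) + 1 / 2) / 4 ^ n, ?_, ?_⟩
    · rw [Metric.mem_ball, Real.dist_eq]
      refine lt_trans ?_ hn
      have h5 : (2 ^ n * (p : ℝ) + (x n : ℕ) + 1 / 2) / 4 ^ n - y =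
          ((p - y * 2 ^ n) + ((x n : ℕ) + 1 / 2) / 2 ^ n) * (1 / 2) ^ n := by
        rw [h4, one_div_pow]; field_simp
        ring
      have h6 : (((x n : ℕ) : ℝ) + 1 / 2) / 2 ^ n < 1 := by
        rw [div_lt_one h2]; linarith
      have h7 : 0 < (((x n : ℕ) : ℝ) + 1 / 2) / 2 ^ n := by positivity
      rw [h5, abs_mul, abs_of_pos (by positivity : (0 : ℝ) < (1 / 2) ^ n)]
      have h8 : |(p - y * 2 ^ n) + (((x n : ℕ) : ℝ) + 1 / 2) / 2 ^ n| < 1 := by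
        rw [abs_lt]; constructor <;> linarith
      exact mul_lt_of_lt_one_left (by positivity) h8
    · refine Set.mem_iUnion.2 ⟨n, Set.mem_iUnion.2 ⟨hmn, Set.mem_iUnion.2 ⟨p, ?_, ?_⟩⟩⟩
      · exact div_lt_div_of_pos_right (by linarith) (by positivity)
      · exact div_lt_div_of_pos_right (by linarith) (by positivity)
  refine mem_of_superset (residual_of_dense_open hO hOd) ?_
  intro y hy
  simp only [O, Set.mem_iUnion] at hy
  obtain ⟨n, hmn, p, h1, h2⟩ := hy
  refine ⟨n, hmn, ?_⟩
  have h4 : (0 : ℝ) < 4 ^ n := by positivity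
  rw [div_lt_iff₀ h4] at h1
  rw [lt_div_iff₀ h4] at h2
  have hfl : ⌊y * 4 ^ n⌋ = 2 ^ n * p + (x n : ℕ) := by
    rw [Int.floor_eq_iff]
    push_cast
    exact ⟨h1.le, h2⟩
  ext
  simp only [rapidDigits, hfl]
  rw [Int.mul_add_emod_self_left, Int.emod_eq_of_lt (by positivity)]
  · simp
  · exact_mod_cast (x n).2

/-- A family of slaloms almost containing the digits of every point of a nonmeagre set of reals is
hitting. -/
theorem hitting_of_not_isMeagre {Y : Set ℝ} (hY : ¬ IsMeagre Y) {F : Set Slalom}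
    (hF : ∀ y ∈ Y, ∃ S ∈ F, ∀ᶠ n in atTop, rapidDigits y n ∈ S n) : Hitting F := by
  intro x
  obtain ⟨y, hyY, hy⟩ : ∃ y ∈ Y, ∀ k, ∃ᶠ n in atTop, rapidDigits y n = x k n := by
    by_contra! h
    refine hY (mem_of_superset (countable_iInter_mem.2 fun k =>
      rapidDigits_frequently_mem_residual (x k)) fun y hy hyY => ?_)
    obtain ⟨k, hk⟩ := h y hyY
    exact Set.mem_iInter.1 hy k hk
  obtain ⟨S, hS, hyS⟩ := hF y hyY
  exact ⟨S, hS, fun k => ((hy k).and_eventually hyS).mono fun n hn => hn.1 ▸ hn.2⟩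

/-! ### The well-ordered chain of slaloms -/

/-- Enumerate a nonmeagre set of least size in its initial ordinal and recurse: each slalom is a
thin bound of all earlier ones, enlarged by the digits of the current point. Every proper initial
segment has fewer than non(M) = add(N) members, so the bound exists. -/
theorem exists_hitting_chain (h : additivity nullIdeal = uniformity meagreIdeal) :
    ∃ (κ : Type) (_ : LinearOrder κ) (_ : WellFoundedLT κ) (S : κ → Slalom),
      (∀ a, (S a).Thin) ∧ (∀ a b, a ≤ b → (S a).AELe (S b)) ∧ Hitting (Set.range S) := by
  obtain ⟨Y, hY, hYc⟩ : uniformity meagreIdeal ∈ {κ | ∃ X : Set ℝ, X ∉ meagreIdeal ∧ #X = κ} :=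
    csInf_mem ⟨_, Set.univ, not_isMeagre_of_isOpen isOpen_univ Set.univ_nonempty, rfl⟩
  let κ := (uniformity meagreIdeal).ord.ToType
  obtain ⟨q⟩ : Nonempty (κ ≃ Y) := by
    rw [← Cardinal.eq, hYc]; exact mk_ord_toType _
  -- The bound is made total, with the empty slalom as default, so that the recursion need not carry
  -- thinness along.
  have hbd : ∀ A : Set Slalom, ∃ T : Slalom, T.Thin ∧
      ((∀ S ∈ A, S.Thin) → #A < additivity nullIdeal → ∀ S ∈ A, S.AELe T) := by
    intro A
    by_cases hA : (∀ S ∈ A, S.Thin) ∧ #A < additivity nullIdeal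
    · obtain ⟨T, h1, h2⟩ := exists_thin_bound A hA.1 hA.2
      exact ⟨T, h1, fun _ _ => h2⟩
    · exact ⟨fun _ => ∅, by simp [Slalom.Thin], fun h1 h2 => (hA ⟨h1, h2⟩).elim⟩
  choose bd hbd1 hbd2 using hbd
  let S : κ → Slalom := WellFounded.fix (wellFounded_lt (α := κ)) fun a rec n =>
    bd {T | ∃ b, ∃ hb : b < a, T = rec b hb} n ∪ {rapidDigits (q a) n}
  have hS : ∀ a, S a = fun n => bd {T | ∃ b, ∃ _ : b < a, T = S b} n ∪ {rapidDigits (q a) n} := by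
    intro a
    exact WellFounded.fix_eq _ _ _
  have hthin : ∀ a, (S a).Thin := by
    intro a
    rw [hS]
    refine (hbd1 _).union (Slalom.thin_of_card_le fun n => ?_)
    simp
  refine ⟨κ, inferInstance, inferInstance, S, hthin, fun a b hab => ?_, ?_⟩
  · rcases hab.eq_or_lt with rfl | hab
    · exact Eventually.of_forall fun n => subset_rfl
    have hc : #{T | ∃ c, ∃ _ : c < b, T = S c} < additivity nullIdeal := by
      have : {T | ∃ c, ∃ _ : c < b, T = S c} = S '' Set.Iio b := by
        ext T; simp [eq_comm]
      rw [this, h]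
      refine mk_image_le.trans_lt ?_
      exact (mk_Iio_lt b (by rw [mk_ord_toType, type_toType])).trans_eq (mk_ord_toType _)
    filter_upwards [hbd2 _ (by rintro _ ⟨c, _, rfl⟩; exact hthin c) hc (S a) ⟨a, hab, rfl⟩]
      with n hn
    rw [hS b]
    exact hn.trans Finset.subset_union_left
  · refine hitting_of_not_isMeagre hY fun y hy => ⟨_, ⟨q.symm ⟨y, hy⟩, rfl⟩, ?_⟩
    refine Eventually.of_forall fun n => ?_
    rw [hS]
    simp

/-! ### The compactification of the tree of nodes -/

/-- Finite initial segments of branches. -/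
abbrev Node : Type := Σ k : ℕ, ∀ j : Fin k, Fin (2 ^ (j : ℕ))

/-- Names for the subsets of `Node` that generate the compactification. -/
inductive Label (κ : Type) : Type
  | node (t : Node) : Label κ
  | digit (n : ℕ) (i : Fin (2 ^ n)) : Label κ
  | avoid (a : κ) (m : ℕ) : Label κ

variable {κ : Type} (S : κ → Slalom)

/-- The set of nodes named by a label. -/
def Holds : Label κ → Node → Prop
  | .node t, s => s = t
  | .digit n i, s => ∃ h : n < s.1, s.2 ⟨n, h⟩ = i
  | .avoid a m, s => ∀ j (h : j < s.1), m ≤ j → s.2 ⟨j, h⟩ ∉ S a j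

/-- The set of branches named by a label. -/
def LimHolds : Label κ → Branch → Prop
  | .node _, _ => False
  | .digit n i, x => x n = i
  | .avoid a m, x => ∀ j, m ≤ j → x j ∉ S a j

open Classical in
/-- The point of the Cantor cube given by a node. -/
noncomputable def nodeCode (s : Node) : Label κ → Bool := fun l => decide (Holds S l s)

/-- The closure of the set of nodes in the Cantor cube. -/
abbrev Space : Type := closure (Set.range (nodeCode S))

instance : CompactSpace (Space S) := isCompact_iff_compactSpace.1 isClosed_closure.isCompact

/-- The embedding of the nodes. -/
noncomputable def emb (s : Node) : Space S := ⟨nodeCode S s, subset_closure ⟨s, rfl⟩⟩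

/-- The initial segment of length `k` of a branch. -/
def take (x : Branch) (k : ℕ) : Node := ⟨k, fun j => x j⟩

/-- The branch that starts with a node and continues like a given branch. -/
def graft (s : Node) (x : Branch) : Branch := fun j => if h : j < s.1 then s.2 ⟨j, h⟩ else x j

variable {S}

theorem emb_val (s : Node) (l : Label κ) : (emb S s).1 l = true ↔ Holds S l s := by
  simp [emb, nodeCode]

/-- Each label stabilises along a branch: initial segments inherit avoidance, and a failure to avoid
shows at one finite coordinate. -/
theorem eventually_holds_take (x : Branch) (l : Label κ) :
    ∀ᶠ k in atTop, (Holds S l (take x k) ↔ LimHolds S l x) := by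
  cases l with
  | node t =>
    filter_upwards [eventually_gt_atTop t.1] with k hk
    refine iff_of_false (fun h => ?_) id
    have h1 : take x k = t := h
    rw [← h1] at hk
    exact lt_irrefl _ hk
  | digit n i =>
    filter_upwards [eventually_gt_atTop n] with k hk
    exact ⟨fun ⟨_, h⟩ => h, fun h => ⟨hk, h⟩⟩
  | avoid a m =>
    by_cases h : LimHolds S (.avoid a m) x
    · exact Eventually.of_forall fun k => iff_of_true (fun j _ hm => h j hm) h
    · have h' : ∃ j, m ≤ j ∧ x j ∈ S a j := by simpa [LimHolds] using h
      obtain ⟨j, hj, hjx⟩ := h'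
      filter_upwards [eventually_gt_atTop j] with k hk
      exact iff_of_false (fun h1 => h1 j hk hj hjx) h

open Classical in
theorem tendsto_nodeCode_take (x : Branch) :
    Tendsto (fun k => nodeCode S (take x k)) atTop (𝓝 fun l => decide (LimHolds S l x)) := by
  rw [tendsto_pi_nhds]
  intro l
  refine tendsto_nhds_of_eventually_eq ?_
  filter_upwards [eventually_holds_take (S := S) x l] with k hk
  simp only [nodeCode, hk]

variable (S) in
open Classical in
/-- The limit of the initial segments of a branch. -/
noncomputable def branchPoint (x : Branch) : Space S :=
  ⟨fun l => decide (LimHolds S l x), mem_closure_of_tendsto (tendsto_nodeCode_take x)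
    (Eventually.of_forall fun _ => ⟨_, rfl⟩)⟩

theorem branchPoint_val (x : Branch) (l : Label κ) :
    (branchPoint S x).1 l = true ↔ LimHolds S l x := by
  simp [branchPoint]

theorem tendsto_emb_take (x : Branch) :
    Tendsto (fun k => emb S (take x k)) atTop (𝓝 (branchPoint S x)) :=
  tendsto_subtype_rng.2 (tendsto_nodeCode_take x)

/-- The transfer principle used throughout: nodes are dense, so a relation between finitely many
labels that holds at all nodes holds at every point. -/
theorem exists_node_agree (p : Space S) (F : Finset (Label κ)) :
    ∃ s : Node, ∀ l ∈ F, (p.1 l = true ↔ Holds S l s) := by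
  have hU : IsOpen {q : Label κ → Bool | ∀ l ∈ F, q l = p.1 l} := by
    have : {q : Label κ → Bool | ∀ l ∈ F, q l = p.1 l} =
        ⋂ l ∈ F, (fun q => q l) ⁻¹' {p.1 l} := by ext q; simp
    rw [this]
    exact isOpen_biInter_finset fun l _ => (isOpen_discrete _).preimage (continuous_apply l)
  obtain ⟨_, hq, s, rfl⟩ := mem_closure_iff.1 p.2 _ hU fun l _ => rfl
  refine ⟨s, fun l hl => ?_⟩
  rw [← hq l hl]
  simp [nodeCode]

theorem eq_emb_of_node {p : Space S} {t : Node} (h : p.1 (.node t) = true) : p = emb S t := by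
  classical
  refine Subtype.ext (funext fun l => ?_)
  obtain ⟨s, hs⟩ := exists_node_agree p {.node t, l}
  obtain rfl : s = t := (hs (.node t) (by simp)).1 h
  rw [Bool.eq_iff_iff, hs l (by simp), emb_val]

theorem emb_node (t : Node) : (emb S t).1 (.node t) = true := (emb_val t _).2 rfl

theorem mem_compl_range_emb {p : Space S} :
    p ∈ (Set.range (emb S))ᶜ ↔ ∀ t, p.1 (.node t) = false := by
  constructor
  · intro h t
    by_contra h1
    exact h ⟨t, (eq_emb_of_node (by simpa using h1)).symm⟩
  · rintro h ⟨t, rfl⟩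
    have := h t
    rw [emb_node] at this
    exact absurd this (by simp)

theorem isOpen_setOf_val (l : Label κ) : IsOpen {p : Space S | p.1 l = true} :=
  (isOpen_discrete ({true} : Set Bool)).preimage (f := fun p : Space S => p.1 l)
    ((continuous_apply l).comp continuous_subtype_val)

theorem isOpen_singleton_emb (t : Node) : IsOpen {emb S t} := by
  convert isOpen_setOf_val (S := S) (.node t) using 1
  ext p
  simp only [Set.mem_singleton_iff, Set.mem_ofPred_eq]
  exact ⟨fun h => h ▸ emb_node t, eq_emb_of_node⟩

theorem isClosed_compl_range_emb : IsClosed (Set.range (emb S))ᶜ := by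
  have h : Set.range (emb S) = ⋃ t, {emb S t} := (Set.iUnion_singleton_eq_range _).symm
  rw [isClosed_compl_iff]
  exact h ▸ isOpen_iUnion isOpen_singleton_emb

theorem branchPoint_mem (x : Branch) : branchPoint S x ∈ (Set.range (emb S))ᶜ := by
  rw [mem_compl_range_emb]
  intro t
  rw [← Bool.not_eq_true, branchPoint_val]
  exact id

theorem emb_injective : Function.Injective (emb S) := by
  intro s t h
  exact (emb_val s (.node t)).1 (h ▸ emb_node t)

theorem dense_range_emb : DenseRange (emb S) := by
  intro p
  rw [closure_subtype]
  rw [← Set.range_comp]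
  exact p.2

theorem isDenseEmbedding_emb (q : ℕ ≃ Node) : IsDenseEmbedding (emb S ∘ q) where
  dense := by
    rw [DenseRange, EquivLike.range_comp]; exact dense_range_emb
  injective := emb_injective.comp q.injective
  eq_induced := by
    refine (IsOpenEmbedding.of_continuous_injective_isOpenMap continuous_of_discreteTopology
      (emb_injective.comp q.injective) fun U _ => ?_).eq_induced
    rw [← Set.biUnion_of_singleton U, Set.image_iUnion₂]
    refine isOpen_biUnion fun n _ => ?_
    rw [Set.image_singleton]
    exact isOpen_singleton_emb (q n)

theorem finite_setOf_length_le (k : ℕ) : {s : Node | s.1 ≤ k}.Finite := by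
  have : {s : Node | s.1 ≤ k} ⊆ ⋃ j ∈ Set.Iic k, Set.range (Sigma.mk j) := by
    rintro ⟨j, f⟩ hj
    exact Set.mem_biUnion hj ⟨f, rfl⟩
  exact ((Set.finite_Iic k).biUnion fun j _ => Set.finite_range _).subset this

theorem tendsto_length : Tendsto (fun s : Node => s.1) cofinite atTop := by
  rw [tendsto_atTop]
  intro k
  refine Set.Finite.subset (finite_setOf_length_le k) fun s hs => ?_
  exact (not_le.1 (show ¬ k ≤ s.1 from hs)).le

/-! ### Coordinate functions -/

variable (S) in
/-- The continuous function given by a coordinate. -/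
noncomputable def coord (l : Label κ) : C(Space S, ℝ) where
  toFun p := if p.1 l = true then 1 else 0
  continuous_toFun := (continuous_of_discreteTopology (f := fun b : Bool =>
    if b = true then (1 : ℝ) else 0)).comp ((continuous_apply l).comp continuous_subtype_val)

theorem coord_apply (l : Label κ) (p : Space S) :
    coord S l p = if p.1 l = true then 1 else 0 := rfl

theorem coord_nonneg (l : Label κ) (p : Space S) : 0 ≤ coord S l p := by
  rw [coord_apply]; split_ifs <;> norm_num

theorem coord_le_one (l : Label κ) (p : Space S) : coord S l p ≤ 1 := by
  rw [coord_apply]; split_ifs <;> norm_num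

/-- A property of continuous functions that holds for coordinates and is preserved by the algebra
operations and by uniform limits holds for all continuous functions. -/
theorem continuousMap_induction {Q : C(Space S, ℝ) → Prop}
    (const : ∀ c : ℝ, Q (algebraMap ℝ _ c)) (coord : ∀ l, Q (coord S l))
    (add : ∀ f g, Q f → Q g → Q (f + g)) (mul : ∀ f g, Q f → Q g → Q (f * g))
    (lim : ∀ f, (∀ ε > 0, ∃ g, Q g ∧ ‖f - g‖ < ε) → Q f) (f : C(Space S, ℝ)) : Q f := by
  let A : Subalgebra ℝ C(Space S, ℝ) :=
    { carrier := {f | Q f}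
      mul_mem' := fun hf hg => mul _ _ hf hg
      add_mem' := fun hf hg => add _ _ hf hg
      algebraMap_mem' := const }
  have hA : A.SeparatesPoints := by
    intro p q hpq
    obtain ⟨l, hl⟩ := Function.ne_iff.1 (Subtype.coe_ne_coe.2 hpq)
    refine ⟨_, ⟨OmegaCompactification.coord S l, coord l, rfl⟩, ?_⟩
    simp only [coord_apply]
    cases hp : p.1 l <;> cases hq : q.1 l <;> simp_all
  have hf : f ∈ A.topologicalClosure := by
    rw [ContinuousMap.subalgebra_topologicalClosure_eq_top_of_separatesPoints A hA]
    trivial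
  refine lim f fun ε hε => ?_
  obtain ⟨g, hg, hfg⟩ := Metric.mem_closure_iff.1 (show f ∈ closure (A : Set _) from hf) ε hε
  exact ⟨g, hg, by rwa [← dist_eq_norm]⟩

/-! ### The growth is not separable -/

/-- Only the finitely many nodes of length at most `n` lack an `n`-th digit, and a point of the
growth differs from each of them on a node label. -/
theorem exists_digit {p : Space S} (hp : p ∈ (Set.range (emb S))ᶜ) (n : ℕ) :
    ∃ i, p.1 (.digit n i) = true := by
  classical
  obtain ⟨s, hs⟩ := exists_node_agree p
    (Finset.univ.image (fun i => Label.digit n i) ∪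
      (finite_setOf_length_le n).toFinset.image Label.node)
  by_cases h : s.1 ≤ n
  · have h1 := (hs (.node s) (by simp [h])).2 rfl
    rw [mem_compl_range_emb.1 hp s] at h1
    exact absurd h1 (by simp)
  · push Not at h
    exact ⟨s.2 ⟨n, h⟩, (hs (.digit n _) (by simp)).2 ⟨h, rfl⟩⟩

theorem not_avoid_of_digit {p : Space S} {n m : ℕ} {i : Fin (2 ^ n)} {a : κ}
    (hi : p.1 (.digit n i) = true) (hia : i ∈ S a n) (hmn : m ≤ n) :
    p.1 (.avoid a m) = false := by
  classical
  rw [← Bool.not_eq_true]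
  intro h
  obtain ⟨s, hs⟩ := exists_node_agree p {.digit n i, .avoid a m}
  obtain ⟨hn, rfl⟩ := (hs (.digit n i) (by simp)).1 hi
  exact (hs (.avoid a m) (by simp)).1 h n hn hmn hia

/-- Thinness pushes the densities below 1, so from some coordinate on a value outside the slalom
remains. -/
theorem exists_limHolds_avoid {a : κ} (ha : (S a).Thin) : ∃ m x, LimHolds S (.avoid a m) x := by
  have h1 := ha.tendsto_atTop_zero.eventually_lt_const (zero_lt_one)
  obtain ⟨m, hm⟩ := eventually_atTop.1 h1
  have h2 : ∀ n, ∃ i, m ≤ n → i ∉ S a n := by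
    intro n
    by_cases hn : m ≤ n
    · by_contra! h
      have h3 : S a n = Finset.univ := Finset.eq_univ_iff_forall.2 fun i => (h i).2
      have h4 := hm n hn
      simp [h3] at h4
    · exact ⟨0, fun h => (hn h).elim⟩
  choose x hx using h2
  exact ⟨m, x, fun n hn => hx n hn⟩

/-- Read off a branch of digits from each point of a supposed dense sequence. One slalom meets all
these branches infinitely often, so the nonempty clopen sets given by its avoidance labels contain
no point of the sequence. -/
theorem not_separableSpace_growth (hS : ∀ a, (S a).Thin) (hH : Hitting (Set.range S)) :
    ¬ TopologicalSpace.SeparableSpace ((Set.range (emb S))ᶜ : Set (Space S)) := by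
  intro hsep
  have : Nonempty ((Set.range (emb S))ᶜ : Set (Space S)) :=
    ⟨⟨branchPoint S fun _ => 0, branchPoint_mem _⟩⟩
  obtain ⟨u, hu⟩ := TopologicalSpace.exists_dense_seq ((Set.range (emb S))ᶜ : Set (Space S))
  choose x hx using fun k => exists_digit (u k).2
  obtain ⟨_, ⟨a, rfl⟩, ha⟩ := hH x
  obtain ⟨m, y, hy⟩ := exists_limHolds_avoid (hS a)
  obtain ⟨k, hk⟩ := hu.exists_mem_open
    ((isOpen_setOf_val (S := S) (.avoid a m)).preimage continuous_subtype_val)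
    ⟨⟨branchPoint S y, branchPoint_mem y⟩, (branchPoint_val y _).2 hy⟩
  obtain ⟨n, hn, hmn⟩ := ((ha k).and_eventually (eventually_ge_atTop m)).exists
  have h1 : (u k).1.1 (.avoid a m) = true := hk
  rw [not_avoid_of_digit (hx k n) hn hmn] at h1
  exact absurd h1 (by simp)

/-! ### Averages over branches through a node -/

theorem measurable_graft (s : Node) : Measurable (graft s) := by
  refine measurable_pi_lambda _ fun j => ?_
  by_cases h : j < s.1
  · simp only [graft, h, dite_true]; exact measurable_const
  · simp only [graft, h, dite_false]; exact measurable_pi_apply j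

/-- The function is a pointwise limit of functions of finitely many digits; no measurability of
`branchPoint` itself is needed. -/
theorem measurable_comp_branchPoint (f : C(Space S, ℝ)) :
    Measurable fun x => f (branchPoint S x) := by
  refine measurable_of_tendsto_metrizable (f := fun k x => f (emb S (take x k))) (fun k => ?_)
    (tendsto_pi_nhds.2 fun x => (f.continuous.tendsto _).comp (tendsto_emb_take x))
  let g : (∀ j : Fin k, Fin (2 ^ (j : ℕ))) → ℝ := fun y => f (emb S ⟨k, y⟩)
  exact (measurable_of_finite g).comp (measurable_pi_lambda _ fun j => measurable_pi_apply (j : ℕ))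

theorem measurable_comp_graft (f : C(Space S, ℝ)) (s : Node) :
    Measurable fun x => f (branchPoint S (graft s x)) :=
  (measurable_comp_branchPoint f).comp (measurable_graft s)

theorem integrable_comp_graft (f : C(Space S, ℝ)) (s : Node) :
    Integrable (fun x => f (branchPoint S (graft s x))) branchMeasure :=
  Integrable.of_bound (measurable_comp_graft f s).aestronglyMeasurable ‖f‖
    (Eventually.of_forall fun _ => f.norm_coe_le_norm _)

/-- The mean oscillation of a function between a node and the branches through it. -/
noncomputable def meanOsc (f : C(Space S, ℝ)) (s : Node) : ℝ :=
  ∫ x, |f (branchPoint S (graft s x)) - f (emb S s)| ∂branchMeasure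

theorem integrable_osc (f : C(Space S, ℝ)) (s : Node) :
    Integrable (fun x => |f (branchPoint S (graft s x)) - f (emb S s)|) branchMeasure :=
  ((integrable_comp_graft f s).sub (integrable_const _)).abs

theorem meanOsc_nonneg (f : C(Space S, ℝ)) (s : Node) : 0 ≤ meanOsc f s :=
  integral_nonneg fun _ => abs_nonneg _

theorem meanOsc_add_le (f g : C(Space S, ℝ)) (s : Node) :
    meanOsc (f + g) s ≤ meanOsc f s + meanOsc g s := by
  unfold meanOsc
  rw [← integral_add (integrable_osc f s) (integrable_osc g s)]
  refine integral_mono (integrable_osc _ s) ((integrable_osc f s).add (integrable_osc g s))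
    fun x => ?_
  refine le_trans (le_of_eq ?_) (abs_add_le _ _)
  simp only [ContinuousMap.add_apply]
  ring_nf

theorem meanOsc_mul_le (f g : C(Space S, ℝ)) (s : Node) :
    meanOsc (f * g) s ≤ ‖g‖ * meanOsc f s + ‖f‖ * meanOsc g s := by
  unfold meanOsc
  rw [← integral_const_mul, ← integral_const_mul,
    ← integral_add ((integrable_osc f s).const_mul _) ((integrable_osc g s).const_mul _)]
  refine integral_mono (integrable_osc _ s)
    (((integrable_osc f s).const_mul _).add ((integrable_osc g s).const_mul _)) fun x => ?_
  set p := branchPoint S (graft s x)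
  simp only [ContinuousMap.mul_apply]
  have h : f p * g p - f (emb S s) * g (emb S s) =
      g p * (f p - f (emb S s)) + f (emb S s) * (g p - g (emb S s)) := by ring
  rw [h]
  refine (abs_add_le _ _).trans ?_
  rw [abs_mul, abs_mul]
  gcongr
  · exact g.norm_coe_le_norm p
  · exact f.norm_coe_le_norm (emb S s)

theorem meanOsc_le_add_norm_sub (f g : C(Space S, ℝ)) (s : Node) :
    meanOsc f s ≤ meanOsc g s + 2 * ‖f - g‖ := by
  have h : meanOsc (f - g) s ≤ 2 * ‖f - g‖ := by
    unfold meanOsc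
    refine (integral_mono (integrable_osc _ s) (integrable_const (2 * ‖f - g‖)) fun x => ?_).trans
      (by simp)
    refine (abs_sub _ _).trans ?_
    have h1 := (f - g).norm_coe_le_norm (branchPoint S (graft s x))
    have h2 := (f - g).norm_coe_le_norm (emb S s)
    rw [Real.norm_eq_abs] at h1 h2
    linarith
  have h2 := meanOsc_add_le g (f - g) s
  have h3 : g + (f - g) = f := by ext; simp
  rw [h3] at h2
  linarith

theorem branchMeasure_real_exists_mem_le {T : Slalom} (hT : T.Thin) (k : ℕ) :
    branchMeasure.real {x | ∃ n, k ≤ n ∧ x n ∈ T n} ≤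
      ∑' n, ((T (n + k)).card : ℝ) / 2 ^ (n + k) := by
  have h1 : {x : Branch | ∃ n, k ≤ n ∧ x n ∈ T n} ⊆ ⋃ n, {x | x (n + k) ∈ T (n + k)} := by
    rintro x ⟨n, hn, hx⟩
    refine Set.mem_iUnion.2 ⟨n - k, ?_⟩
    rw [Set.mem_ofPred_eq, Nat.sub_add_cancel hn]
    exact hx
  have hs : Summable fun n => ((T (n + k)).card : ℝ) / 2 ^ (n + k) :=
    (summable_nat_add_iff (f := fun n => ((T n).card : ℝ) / 2 ^ n) k).2 hT
  refine ENNReal.toReal_le_of_le_ofReal (tsum_nonneg fun n => by positivity) ?_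
  refine (measure_mono h1).trans ((measure_iUnion_le _).trans (le_of_eq ?_))
  rw [ENNReal.ofReal_tsum_of_nonneg (fun n => by positivity) hs]
  exact tsum_congr fun n => branchMeasure_coord _ _

/-- The label can differ between `s` and a branch through it only if the branch meets the slalom
beyond `s`; the union bound gives the tail of the densities, uniformly in `m`. -/
theorem meanOsc_coord_avoid_le (a : κ) (ha : (S a).Thin) (m : ℕ) (s : Node) :
    meanOsc (coord S (.avoid a m)) s ≤
      ∑' n, ((S a (n + s.1)).card : ℝ) / 2 ^ (n + s.1) := by
  classical
  refine le_trans ?_ (branchMeasure_real_exists_mem_le ha s.1)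
  have hmeas : MeasurableSet {x : Branch | ∃ n, s.1 ≤ n ∧ x n ∈ S a n} := by
    have : {x : Branch | ∃ n, s.1 ≤ n ∧ x n ∈ S a n} =
        ⋃ n, ⋃ (_ : s.1 ≤ n), (fun x : Branch => x n) ⁻¹' (S a n : Set (Fin (2 ^ n))) := by
      ext x; simp
    rw [this]
    exact MeasurableSet.iUnion fun n => MeasurableSet.iUnion fun _ =>
      measurable_pi_apply n MeasurableSet.of_discrete
  rw [← integral_indicator_one hmeas]
  refine integral_mono (integrable_osc _ s)
    ((integrable_const (1 : ℝ)).indicator hmeas) fun x => ?_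
  simp only [coord_apply, branchPoint_val, emb_val, Set.indicator_apply, Set.mem_ofPred_eq,
    Pi.one_apply]
  have key : (¬ ∃ n, s.1 ≤ n ∧ x n ∈ S a n) →
      (LimHolds S (.avoid a m) (graft s x) ↔ Holds S (.avoid a m) s) := by
    intro hx
    push Not at hx
    constructor
    · intro h j hj hmj
      have := h j hmj
      simpa [graft, hj] using this
    · intro h j hmj
      by_cases hj : j < s.1
      · simpa [graft, hj] using h j hj hmj
      · simpa [graft, hj] using hx j (not_lt.1 hj)
  by_cases hx : ∃ n, s.1 ≤ n ∧ x n ∈ S a n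
  · rw [if_pos hx]
    split_ifs <;> norm_num
  · rw [if_neg hx]
    simp [key hx]

/-- Node and digit labels have zero oscillation at all but finitely many nodes, avoidance labels
oscillate by at most a tail of a convergent series, and the property passes to sums, products and
uniform limits. -/
theorem tendsto_meanOsc (hS : ∀ a, (S a).Thin) (f : C(Space S, ℝ)) :
    Tendsto (meanOsc f) cofinite (𝓝 0) := by
  induction f using continuousMap_induction with
  | const c =>
    refine tendsto_const_nhds.congr fun s => ?_
    simp [meanOsc]
  | coord l =>
    cases l with
    | node t =>
      refine tendsto_const_nhds.congr' ?_
      filter_upwards [(Set.finite_singleton t).compl_mem_cofinite] with s hs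
      have h1 : ¬ Holds S (.node t) s := hs
      have h2 : ∀ x, ¬ LimHolds S (.node t) x := fun x => id
      simp [meanOsc, coord_apply, branchPoint_val, emb_val, h1, h2]
    | digit n i =>
      refine tendsto_const_nhds.congr' ?_
      filter_upwards [tendsto_length.eventually_gt_atTop n] with s hs
      have h1 : ∀ x, (branchPoint S (graft s x)).1 (.digit n i) = (emb S s).1 (.digit n i) := by
        intro x
        rw [Bool.eq_iff_iff, branchPoint_val, emb_val]
        simp [LimHolds, Holds, graft, hs]
      simp [meanOsc, coord_apply, h1]
    | avoid a m =>
      have h1 := (tendsto_sum_nat_add fun n => ((S a n).card : ℝ) / 2 ^ n).comp tendsto_length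
      exact squeeze_zero (fun s => meanOsc_nonneg _ s)
        (fun s => meanOsc_coord_avoid_le a (hS a) m s) h1
  | add f g hf hg =>
    have h := hf.add hg
    rw [add_zero] at h
    exact squeeze_zero (fun s => meanOsc_nonneg _ s) (meanOsc_add_le f g) h
  | mul f g hf hg =>
    have h := (hf.const_mul ‖g‖).add (hg.const_mul ‖f‖)
    rw [mul_zero, mul_zero, add_zero] at h
    exact squeeze_zero (fun s => meanOsc_nonneg _ s) (meanOsc_mul_le f g) h
  | lim f h =>
    rw [Metric.tendsto_nhds]
    intro ε hε
    obtain ⟨g, hg, hfg⟩ := h (ε / 4) (by positivity)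
    filter_upwards [hg.eventually_lt_const (by positivity : (0 : ℝ) < ε / 4)] with s hs
    rw [Real.dist_0_eq_abs, abs_of_nonneg (meanOsc_nonneg _ s)]
    linarith [meanOsc_le_add_norm_sub f g s]

variable (S) in
/-- The average of a function over the branches through a node. -/
noncomputable def average (s : Node) (f : C(Space S, ℝ)) : ℝ :=
  ∫ x, f (branchPoint S (graft s x)) ∂branchMeasure

theorem average_add (s : Node) (f g : C(Space S, ℝ)) :
    average S s (f + g) = average S s f + average S s g :=
  integral_add (integrable_comp_graft f s) (integrable_comp_graft g s)

theorem average_smul (s : Node) (c : ℝ) (f : C(Space S, ℝ)) :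
    average S s (c • f) = c * average S s f :=
  integral_const_mul _ _

theorem abs_average_le (s : Node) (f : C(Space S, ℝ)) : |average S s f| ≤ ‖f‖ := by
  have h := norm_integral_le_of_norm_le_const (μ := branchMeasure) (C := ‖f‖)
    (f := fun x => f (branchPoint S (graft s x))) (Eventually.of_forall fun x =>
      f.norm_coe_le_norm _)
  simpa [average] using h

theorem abs_sub_average_le (s : Node) (f : C(Space S, ℝ)) :
    |f (emb S s) - average S s f| ≤ meanOsc f s := by
  have h : average S s f - f (emb S s) =
      ∫ x, (f (branchPoint S (graft s x)) - f (emb S s)) ∂branchMeasure := by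
    rw [integral_sub (integrable_comp_graft f s) (integrable_const _)]
    simp [average]
  rw [abs_sub_comm, h]
  exact abs_integral_le_integral_abs

theorem average_eq_zero {f : C(Space S, ℝ)} (hf : ∀ p ∈ (Set.range (emb S))ᶜ, f p = 0)
    (s : Node) : average S s f = 0 := by
  simp [average, hf _ (branchPoint_mem _)]

/-! ### The natural copy of `c₀` is complemented -/

/-- The continuous function with prescribed null values at the nodes that vanishes on the
growth. -/
noncomputable def extendNull (c : Node → ℝ) (hc : Tendsto c cofinite (𝓝 0)) :
    C(Space S, ℝ) where
  toFun := Function.extend (emb S) c 0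
  continuous_toFun := by
    rw [continuous_iff_continuousAt]
    intro p
    by_cases hp : p ∈ Set.range (emb S)
    · obtain ⟨t, rfl⟩ := hp
      have h1 : 𝓝 (emb S t) = pure (emb S t) :=
        (isOpen_singleton_iff_nhds_eq_pure _).1 (isOpen_singleton_emb t)
      rw [ContinuousAt, h1]
      exact tendsto_pure_nhds _ _
    · rw [ContinuousAt, Function.extend_apply' _ _ _ hp, Pi.zero_apply, Metric.tendsto_nhds]
      intro ε hε
      have hfin : {s | ¬ dist (c s) 0 < ε}.Finite := (Metric.tendsto_nhds.1 hc) ε hε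
      have hopen : IsOpen (emb S '' {s | ¬ dist (c s) 0 < ε})ᶜ :=
        (hfin.image _).isClosed.isOpen_compl
      filter_upwards [hopen.mem_nhds fun h => hp (Set.image_subset_range _ _ h)] with r hr
      by_cases hr' : r ∈ Set.range (emb S)
      · obtain ⟨t, rfl⟩ := hr'
        rw [emb_injective.extend_apply]
        by_contra h
        exact hr ⟨t, h, rfl⟩
      · rw [Function.extend_apply' _ _ _ hr', Pi.zero_apply, dist_self]
        exact hε

theorem extendNull_emb (c : Node → ℝ) (hc : Tendsto c cofinite (𝓝 0)) (s : Node) :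
    extendNull (S := S) c hc (emb S s) = c s :=
  emb_injective.extend_apply _ _ _

theorem extendNull_growth (c : Node → ℝ) (hc : Tendsto c cofinite (𝓝 0)) {p : Space S}
    (hp : p ∈ (Set.range (emb S))ᶜ) : extendNull (S := S) c hc p = 0 :=
  Function.extend_apply' _ _ _ hp

theorem tendsto_sub_average (hS : ∀ a, (S a).Thin) (f : C(Space S, ℝ)) :
    Tendsto (fun s => f (emb S s) - average S s f) cofinite (𝓝 0) :=
  squeeze_zero_norm (fun s => abs_sub_average_le s f) (tendsto_meanOsc hS f)

/-- The projection sends `f` to `f(s) - average` at the nodes and to zero on the growth. It fixes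
functions vanishing on the growth because the averages only see limits of branches. -/
theorem closedComplemented_naturalCopy (hS : ∀ a, (S a).Thin) (q : ℕ ≃ Node) :
    (naturalCopy (emb S ∘ q)).ClosedComplemented := by
  have hgr : growth (emb S ∘ q) = (Set.range (emb S))ᶜ := by
    rw [growth, EquivLike.range_comp]
  let R : C(Space S, ℝ) →ₗ[ℝ] C(Space S, ℝ) :=
    { toFun := fun f => extendNull _ (tendsto_sub_average hS f)
      map_add' := fun f g => by
        ext p
        by_cases hp : p ∈ Set.range (emb S)
        · obtain ⟨t, rfl⟩ := hp
          simp only [ContinuousMap.add_apply, extendNull_emb, average_add]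
          ring
        · simp [extendNull_growth _ _ (Set.mem_compl hp)]
      map_smul' := fun c f => by
        ext p
        by_cases hp : p ∈ Set.range (emb S)
        · obtain ⟨t, rfl⟩ := hp
          simp only [ContinuousMap.smul_apply, extendNull_emb, average_smul,
            RingHom.id_apply]
          ring
        · simp [extendNull_growth _ _ (Set.mem_compl hp)] }
  -- The constant 2 comes from one `‖f‖` for the value and one for the average.
  let R' : C(Space S, ℝ) →L[ℝ] C(Space S, ℝ) := R.mkContinuous 2 fun f => by
    rw [ContinuousMap.norm_le _ (by positivity)]
    intro p
    by_cases hp : p ∈ Set.range (emb S)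
    · obtain ⟨t, rfl⟩ := hp
      have h1 := abs_average_le t f
      have h2 := f.norm_coe_le_norm (emb S t)
      have h3 : R f (emb S t) = f (emb S t) - average S t f :=
        extendNull_emb _ (tendsto_sub_average hS _) t
      rw [h3]
      exact (norm_sub_le _ _).trans (by rw [Real.norm_eq_abs (average S t f)]; linarith)
    · have h3 : R f p = 0 := extendNull_growth _ (tendsto_sub_average hS _) hp
      rw [h3, norm_zero]
      positivity
  refine ⟨R'.codRestrict _ fun f x hx => ?_, fun f => Subtype.ext ?_⟩
  · rw [hgr] at hx
    exact extendNull_growth _ (tendsto_sub_average hS f) hx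
  · ext p
    have hf : ∀ p ∈ (Set.range (emb S))ᶜ, f.1 p = 0 := fun p hp => f.2 p (hgr ▸ hp)
    by_cases hp : p ∈ Set.range (emb S)
    · obtain ⟨t, rfl⟩ := hp
      have h3 : R f (emb S t) = f.1 (emb S t) - average S t f :=
        extendNull_emb _ (tendsto_sub_average hS _) t
      rw [average_eq_zero hf, _root_.sub_zero] at h3
      exact h3
    · rw [hf p hp]
      exact extendNull_growth _ (tendsto_sub_average hS _) hp

/-! ### The growth supports a measure -/

open scoped CompactlySupported

variable (S) in
/-- The limit of the initial segments of a branch, as a point of the growth. -/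
noncomputable def growthPoint (x : Branch) : ((Set.range (emb S))ᶜ : Set (Space S)) :=
  ⟨branchPoint S x, branchPoint_mem x⟩

instance : CompactSpace ((Set.range (emb S))ᶜ : Set (Space S)) :=
  isCompact_iff_compactSpace.1 isClosed_compl_range_emb.isCompact

theorem exists_extension_growth (g : C(((Set.range (emb S))ᶜ : Set (Space S)), ℝ)) :
    ∃ f : C(Space S, ℝ), ∀ p : ((Set.range (emb S))ᶜ : Set (Space S)), f p = g p := by
  obtain ⟨f, hf⟩ := g.exists_restrict_eq isClosed_compl_range_emb
  exact ⟨f, fun p => by rw [← hf]; rfl⟩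

variable (S) in
/-- The average of a function on the growth over the branches through a node. -/
noncomputable def growthAverage (s : Node)
    (g : C(((Set.range (emb S))ᶜ : Set (Space S)), ℝ)) : ℝ :=
  ∫ x, g (growthPoint S (graft s x)) ∂branchMeasure

theorem integrable_growth (s : Node) (g : C(((Set.range (emb S))ᶜ : Set (Space S)), ℝ)) :
    Integrable (fun x => g (growthPoint S (graft s x))) branchMeasure := by
  obtain ⟨f, hf⟩ := exists_extension_growth g
  refine (integrable_comp_graft f s).congr (Eventually.of_forall fun x => ?_)
  exact hf (growthPoint S (graft s x))

theorem abs_growthAverage_le (s : Node) (g : C(((Set.range (emb S))ᶜ : Set (Space S)), ℝ)) :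
    |growthAverage S s g| ≤ ‖g‖ := by
  have h := norm_integral_le_of_norm_le_const (μ := branchMeasure) (C := ‖g‖)
    (f := fun x => g (growthPoint S (graft s x))) (Eventually.of_forall fun x =>
      g.norm_coe_le_norm _)
  simpa [growthAverage] using h

/-- Were all averages zero, an extension of `g` would tend to zero along the nodes, although nodes
outside any finite set accumulate at `p`, where it is positive. -/
theorem exists_growthAverage_pos (hS : ∀ a, (S a).Thin)
    {g : C(((Set.range (emb S))ᶜ : Set (Space S)), ℝ)} (hg : 0 ≤ g)
    (hg' : ∃ p, 0 < g p) : ∃ s, 0 < growthAverage S s g := by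
  by_contra! hneg
  obtain ⟨f, hf⟩ := exists_extension_growth g
  obtain ⟨p, hp⟩ := hg'
  have havg : ∀ s, average S s f = 0 := by
    intro s
    have h1 : average S s f = growthAverage S s g :=
      integral_congr_ae (Eventually.of_forall fun x => hf (growthPoint S (graft s x)))
    exact h1.trans (le_antisymm (hneg s) (integral_nonneg fun x => hg _))
  have hlim := tendsto_sub_average hS f
  simp only [havg, _root_.sub_zero] at hlim
  have hfin : {s | ¬ f (emb S s) < g p / 2}.Finite :=
    hlim.eventually_lt_const (half_pos hp)
  have hopen : IsOpen ({r | g p / 2 < f r} ∩ (emb S '' {s | ¬ f (emb S s) < g p / 2})ᶜ) :=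
    (isOpen_lt continuous_const f.continuous).inter (hfin.image _).isClosed.isOpen_compl
  obtain ⟨s, hs1, hs2⟩ := dense_range_emb.exists_mem_open hopen
    ⟨p, by rw [Set.mem_ofPred_eq, hf p]; exact half_lt_self hp,
      fun h => p.2 (Set.image_subset_range _ _ h)⟩
  exact hs2 ⟨s, not_lt.2 (le_of_lt hs1), rfl⟩

theorem summable_growthAverage (q : ℕ ≃ Node)
    (g : C(((Set.range (emb S))ᶜ : Set (Space S)), ℝ)) :
    Summable fun n => (1 / 2 : ℝ) ^ n * growthAverage S (q n) g := by
  refine Summable.of_norm_bounded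
    ((summable_geometric_of_lt_one (r := (1 / 2 : ℝ)) (by norm_num) (by norm_num)).mul_right ‖g‖)
    fun n => ?_
  rw [norm_mul, Real.norm_of_nonneg (by positivity)]
  exact mul_le_mul_of_nonneg_left (abs_growthAverage_le _ _) (by positivity)

variable (S) in
/-- The weighted sum of all averages, as a positive functional. -/
noncomputable def growthFunctional (q : ℕ ≃ Node) :
    C_c(((Set.range (emb S))ᶜ : Set (Space S)), ℝ) →ₚ[ℝ] ℝ :=
  PositiveLinearMap.mk₀
    { toFun := fun g => ∑' n, (1 / 2 : ℝ) ^ n * growthAverage S (q n) g.toContinuousMap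
      map_add' := fun f g => by
        rw [← (summable_growthAverage q f.toContinuousMap).tsum_add
          (summable_growthAverage q g.toContinuousMap)]
        refine tsum_congr fun n => ?_
        rw [← mul_add]
        congr 1
        exact integral_add (integrable_growth _ _) (integrable_growth _ _)
      map_smul' := fun c g => by
        rw [RingHom.id_apply, _root_.smul_eq_mul, ← tsum_mul_left]
        refine tsum_congr fun n => ?_
        rw [mul_left_comm]
        congr 1
        exact integral_const_mul c _ }
    fun g hg => tsum_nonneg fun n => mul_nonneg (by positivity)
      (integral_nonneg fun x => hg _)

/-- Take the Riesz measure of the weighted sum of averages. A Urysohn function supported in `U` has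
a positive average at some node, hence a positive integral. -/
theorem supportsMeasure_growth (hS : ∀ a, (S a).Thin) (q : ℕ ≃ Node) :
    SupportsMeasure ((Set.range (emb S))ᶜ : Set (Space S)) := by
  let mG : MeasurableSpace ((Set.range (emb S))ᶜ : Set (Space S)) := borel _
  have : BorelSpace ((Set.range (emb S))ᶜ : Set (Space S)) := ⟨rfl⟩
  let μ := RealRMK.rieszMeasure (growthFunctional S q)
  have hμ : μ.Regular := inferInstance
  refine ⟨μ, inferInstance, hμ, fun U hU ⟨p, hp⟩ => ?_⟩
  obtain ⟨f, hf1, hf3, hf4, hf2⟩ := exists_continuousMap_one_of_isCompact_subset_isOpen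
    (isCompact_singleton (x := p)) hU (Set.singleton_subset_iff.2 hp)
  let g : C_c(((Set.range (emb S))ᶜ : Set (Space S)), ℝ) := ⟨f, hf3⟩
  refine lt_of_lt_of_le ?_ (RealRMK.le_rieszMeasure_tsupport_subset (growthFunctional S q)
    (f := g) hf2 hf4)
  rw [ENNReal.ofReal_pos]
  obtain ⟨s, hs⟩ := exists_growthAverage_pos hS (g := f) (fun x => (hf2 x).1)
    ⟨p, by rw [hf1 rfl]; exact one_pos⟩
  refine (summable_growthAverage q f).tsum_pos (fun n => mul_nonneg (by positivity)
    (integral_nonneg fun x => (hf2 _).1)) (q.symm s) ?_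
  rw [q.apply_symm_apply]
  positivity

/-! ### Sequential compactness for chains -/

theorem avoid_mono {p : Space S} {a : κ} {m m' : ℕ} (h : p.1 (.avoid a m) = true) (hm : m ≤ m') :
    p.1 (.avoid a m') = true := by
  classical
  obtain ⟨s, hs⟩ := exists_node_agree p {.avoid a m, .avoid a m'}
  rw [hs _ (by simp)] at h ⊢
  exact fun j hj hmj => h j hj (hm.trans hmj)

theorem avoid_of_subset {p : Space S} {a b : κ} {m : ℕ} (h : p.1 (.avoid b m) = true)
    (hab : ∀ n, m ≤ n → S a n ⊆ S b n) : p.1 (.avoid a m) = true := by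
  classical
  obtain ⟨s, hs⟩ := exists_node_agree p {.avoid a m, .avoid b m}
  rw [hs _ (by simp)] at h ⊢
  exact fun j hj hmj hmem => h j hj hmj (hab j hmj hmem)

/-- Two avoidance labels of one slalom differ by a condition on finitely many digits, so within a
slalom only one cutoff matters for convergence. -/
theorem avoid_iff_of_avoid {p : Space S} {a : κ} {m m' : ℕ} (h : p.1 (.avoid a m') = true) :
    p.1 (.avoid a m) = true ↔
      ∀ j ∈ Finset.Ico m m', ∀ i ∈ S a j, p.1 (.digit j i) = false := by
  classical
  obtain ⟨s, hs⟩ := exists_node_agree p ({.avoid a m, .avoid a m'} ∪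
    (Finset.Ico m m').biUnion fun j => (S a j).image fun i => Label.digit j i)
  rw [hs _ (by simp)] at h ⊢
  have hd : ∀ j ∈ Finset.Ico m m', ∀ i ∈ S a j,
      (p.1 (.digit j i) = true ↔ Holds S (.digit j i) s) := by
    intro j hj i hi
    refine hs _ (Finset.mem_union_right _ (Finset.mem_biUnion.2 ⟨j, hj, ?_⟩))
    exact Finset.mem_image_of_mem _ hi
  constructor
  · intro h1 j hj i hi
    rw [← Bool.not_eq_true, hd j hj i hi]
    rintro ⟨hjs, rfl⟩
    exact h1 j hjs (Finset.mem_Ico.1 hj).1 hi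
  · intro h1 j hj hmj hmem
    by_cases hjm : m' ≤ j
    · exact h j hj hjm hmem
    · have hj' : j ∈ Finset.Ico m m' := Finset.mem_Ico.2 ⟨hmj, not_le.1 hjm⟩
      have h2 := h1 j hj' _ hmem
      rw [← Bool.not_eq_true, hd j hj' _ hmem] at h2
      exact h2 ⟨hj, rfl⟩

theorem exists_tendsto_of_eventually_const {u : ℕ → Space S}
    (h : ∀ l, ∃ b, ∀ᶠ n in atTop, (u n).1 l = b) : ∃ p, Tendsto u atTop (𝓝 p) := by
  choose b hb using h
  have h1 : Tendsto (fun n => (u n).1) atTop (𝓝 b) :=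
    tendsto_pi_nhds.2 fun l => tendsto_nhds_of_eventually_eq (hb l)
  exact ⟨⟨b, isClosed_closure.mem_of_tendsto h1 (Eventually.of_forall fun n => (u n).2)⟩,
    tendsto_subtype_rng.2 h1⟩

/-- The part of a point determined by the countably many labels of nodes and digits. -/
def treePart (p : Space S) : Node ⊕ (Σ n : ℕ, Fin (2 ^ n)) → Bool :=
  Sum.elim (fun t => p.1 (.node t)) fun d => p.1 (.digit d.1 d.2)

theorem exists_subseq_treePart (u : ℕ → Space S) : ∃ φ : ℕ → ℕ, StrictMono φ ∧
    (∀ t, ∃ b, ∀ᶠ n in atTop, (u (φ n)).1 (.node t) = b) ∧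
    ∀ j i, ∃ b, ∀ᶠ n in atTop, (u (φ n)).1 (.digit j i) = b := by
  obtain ⟨c, φ, hφ, hc⟩ := CompactSpace.tendsto_subseq fun n => treePart (u n)
  have key : ∀ x, ∀ᶠ n in atTop, treePart (u (φ n)) x = c x := by
    intro x
    have h1 := tendsto_pi_nhds.1 hc x
    rw [nhds_discrete, tendsto_pure] at h1
    exact h1
  exact ⟨φ, hφ, fun t => ⟨_, key (.inl t)⟩, fun j i => ⟨_, key (.inr ⟨j, i⟩)⟩⟩

/-- Node and digit labels are countably many and stabilise along a subsequence. For the avoidance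
labels a single further subsequence works, chosen at the least slalom that some subsequence fails to
avoid at every cutoff. -/
theorem seqCompactSpace_of_chain [LinearOrder κ] [WellFoundedLT κ]
    (hS : ∀ a b, a ≤ b → (S a).AELe (S b)) : SeqCompactSpace (Space S) := by
  refine ⟨fun u _ => ?_⟩
  obtain ⟨φ₀, hφ₀, hnode, hdigit⟩ := exists_subseq_treePart u
  let v := u ∘ φ₀
  let Bad : κ → (ℕ → ℕ) → Prop := fun a φ =>
    ∀ m, ∀ᶠ n in atTop, (v (φ n)).1 (.avoid a m) = false
  let A : Set κ := {a | ∃ φ, StrictMono φ ∧ Bad a φ}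
  -- For the least `a` in `A`, a witnessing subsequence is bad for every later slalom by almost
  -- inclusion, while no subsequence at all is bad for an earlier one.
  obtain ⟨φ, hφ, hgood⟩ : ∃ φ : ℕ → ℕ, StrictMono φ ∧ ∀ b, Bad b φ ∨ b ∉ A := by
    by_cases hA : A.Nonempty
    · obtain ⟨a, ⟨φ, hφ, hbad⟩, hmin⟩ := wellFounded_lt.has_min A hA
      refine ⟨φ, hφ, fun b => ?_⟩
      rcases lt_or_ge b a with hb | hb
      · exact Or.inr fun h => hmin b h hb
      · left
        intro m
        obtain ⟨k, hk⟩ := eventually_atTop.1 (hS a b hb)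
        filter_upwards [hbad (max m k)] with n hn
        rw [← Bool.not_eq_true] at hn ⊢
        exact fun h => hn (avoid_of_subset (avoid_mono h (le_max_left m k))
          fun j hj => hk j ((le_max_right m k).trans hj))
    · exact ⟨id, strictMono_id, fun b => Or.inr fun h => hA ⟨b, h⟩⟩
  suffices h : ∃ p, Tendsto (u ∘ φ₀ ∘ φ) atTop (𝓝 p) by
    obtain ⟨p, hp⟩ := h
    exact ⟨p, trivial, _, hφ₀.comp hφ, hp⟩
  have hdigit' : ∀ j i, ∃ b, ∀ᶠ n in atTop, (v (φ n)).1 (.digit j i) = b := fun j i =>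
    (hdigit j i).imp fun b hb => hφ.tendsto_atTop.eventually hb
  refine exists_tendsto_of_eventually_const fun l => ?_
  cases l with
  | node t => exact (hnode t).imp fun b hb => hφ.tendsto_atTop.eventually hb
  | digit j i => exact hdigit' j i
  | avoid b m =>
    rcases hgood b with hb | hb
    · exact ⟨false, hb m⟩
    -- Otherwise a diagonal extraction, with avoidance failing at cutoff `m` at the `m`-th step,
    -- would be bad for `b`.
    obtain ⟨m', hm'⟩ : ∃ m', ∀ᶠ n in atTop, (v (φ n)).1 (.avoid b m') = true := by
      by_contra! h
      obtain ⟨ψ, hψ, hψb⟩ := extraction_forall_of_frequently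
        (P := fun m n => (v (φ n)).1 (.avoid b m) = false) fun m =>
          (not_eventually.1 (h m)).mono fun n hn => by simpa using hn
      refine hb ⟨φ ∘ ψ, hφ.comp hψ, fun m => ?_⟩
      filter_upwards [eventually_ge_atTop m] with n hn
      rw [← Bool.not_eq_true]
      intro h1
      have h2 := avoid_mono h1 hn
      exact absurd ((hψb n).symm.trans h2) (by simp)
    choose c hc using hdigit'
    have hc' : ∀ᶠ n in atTop, ∀ j ∈ Finset.Ico m m', ∀ i ∈ S b j,
        (v (φ n)).1 (.digit j i) = c j i := by
      simp only [Filter.eventually_all_finset]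
      exact fun j _ i _ => hc j i
    classical
    refine ⟨decide (∀ j ∈ Finset.Ico m m', ∀ i ∈ S b j, c j i = false), ?_⟩
    filter_upwards [hm', hc'] with n h1 h2
    rw [Bool.eq_iff_iff, decide_eq_true_iff]
    refine (avoid_iff_of_avoid h1).trans ?_
    exact forall₂_congr fun j hj => forall₂_congr fun i hi => by rw [h2 j hj i hi]

/-! ### The space `c₀` -/

/-- A null sequence as an element of `c₀`. -/
def nullSeq (a : ℕ → ℝ) (ha : Tendsto a atTop (𝓝 0)) : C₀(ℕ, ℝ) where
  toFun := a
  continuous_toFun := continuous_of_discreteTopology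
  zero_at_infty' := by rwa [cocompact_eq_cofinite, Nat.cofinite_eq_atTop]

theorem tendsto_c0 (a : C₀(ℕ, ℝ)) : Tendsto a atTop (𝓝 0) := by
  have h := a.zero_at_infty'
  rwa [cocompact_eq_cofinite, Nat.cofinite_eq_atTop] at h

theorem c0_norm_le {a : C₀(ℕ, ℝ)} {C : ℝ} (hC : 0 ≤ C) : ‖a‖ ≤ C ↔ ∀ n, |a n| ≤ C := by
  rw [← ZeroAtInftyContinuousMap.norm_toBCF_eq_norm, BoundedContinuousFunction.norm_le hC]
  rfl

theorem c0_abs_le (a : C₀(ℕ, ℝ)) (n : ℕ) : |a n| ≤ ‖a‖ := (c0_norm_le (norm_nonneg a)).1 le_rfl n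

/-- The unit vectors of `c₀`. -/
noncomputable def c0Single (n : ℕ) : C₀(ℕ, ℝ) :=
  nullSeq (Pi.single n 1) (tendsto_nhds_of_eventually_eq <| by
    filter_upwards [eventually_gt_atTop n] with m hm
    exact Pi.single_eq_of_ne hm.ne' _)

theorem c0Single_apply (n m : ℕ) : c0Single n m = if m = n then 1 else 0 :=
  Pi.single_apply n 1 m

theorem c0_sum_apply (F : Finset ℕ) (a : ℕ → ℝ) (m : ℕ) :
    (∑ n ∈ F, a n • c0Single n) m = if m ∈ F then a m else 0 := by
  have h : (∑ n ∈ F, a n • c0Single n) m = ∑ n ∈ F, (a n • c0Single n) m := by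
    induction F using Finset.cons_induction with
    | empty => rfl
    | cons i F hi ih => rw [Finset.sum_cons, Finset.sum_cons, ← ih]; rfl
  rw [h]
  simp [c0Single_apply]

theorem tendsto_c0_truncate (a : C₀(ℕ, ℝ)) :
    Tendsto (fun N => ∑ n ∈ Finset.range N, a n • c0Single n) atTop (𝓝 a) := by
  rw [Metric.tendsto_atTop]
  intro ε hε
  obtain ⟨N, hN⟩ := Metric.tendsto_atTop.1 (tendsto_c0 a) (ε / 2) (half_pos hε)
  refine ⟨N, fun M hM => lt_of_le_of_lt ?_ (half_lt_self hε)⟩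
  rw [dist_eq_norm, c0_norm_le (half_pos hε).le]
  intro m
  rw [ZeroAtInftyContinuousMap.sub_apply, c0_sum_apply]
  split_ifs with h
  · simpa using (half_pos hε).le
  · have h1 := hN m (hM.trans (by simpa using h))
    rw [Real.dist_0_eq_abs] at h1
    rw [_root_.zero_sub, abs_neg]
    exact h1.le

/-- The isometric embedding of `c₀` into itself along a strictly increasing map of indices. -/
noncomputable def c0Reindex (φ : ℕ → ℕ) (hφ : StrictMono φ) : C₀(ℕ, ℝ) →L[ℝ] C₀(ℕ, ℝ) :=
  LinearMap.mkContinuous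
    { toFun := fun a => nullSeq (Function.extend φ a 0) (by
        rw [← Nat.cofinite_eq_atTop, Metric.tendsto_nhds]
        intro ε hε
        have h1 : {n | ¬ dist (a n) 0 < ε}.Finite := by
          have := (Metric.tendsto_nhds.1 (tendsto_c0 a)) ε hε
          rwa [← Nat.cofinite_eq_atTop] at this
        refine (h1.image φ).subset fun m hm => ?_
        by_cases h : ∃ n, φ n = m
        · obtain ⟨n, rfl⟩ := h
          refine ⟨n, ?_, rfl⟩
          have hm' : ¬ dist (Function.extend φ a 0 (φ n)) 0 < ε := hm
          rwa [hφ.injective.extend_apply] at hm'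
        · have hm' : ¬ dist (Function.extend φ a 0 m) 0 < ε := hm
          rw [Function.extend_apply' _ _ _ h] at hm'
          simp [hε] at hm')
      map_add' := fun a b => by
        ext m
        by_cases h : ∃ n, φ n = m
        · obtain ⟨n, rfl⟩ := h
          simp [nullSeq, hφ.injective.extend_apply]
        · simp [nullSeq, Function.extend_apply' _ _ _ h]
      map_smul' := fun c a => by
        ext m
        by_cases h : ∃ n, φ n = m
        · obtain ⟨n, rfl⟩ := h
          simp [nullSeq, hφ.injective.extend_apply]
        · simp [nullSeq, Function.extend_apply' _ _ _ h] }
    1 fun a => by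
      rw [one_mul, c0_norm_le (norm_nonneg a)]
      intro m
      by_cases h : ∃ n, φ n = m
      · obtain ⟨n, rfl⟩ := h
        simpa [nullSeq, hφ.injective.extend_apply] using c0_abs_le a n
      · simp [nullSeq, Function.extend_apply' _ _ _ h]

theorem c0Reindex_single (φ : ℕ → ℕ) (hφ : StrictMono φ) (n : ℕ) :
    c0Reindex φ hφ (c0Single n) = c0Single (φ n) := by
  ext m
  show Function.extend φ (c0Single n) 0 m = _
  by_cases h : ∃ k, φ k = m
  · obtain ⟨k, rfl⟩ := h
    simp [hφ.injective.extend_apply, c0Single_apply, hφ.injective.eq_iff]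
  · rw [Function.extend_apply' _ _ _ h, c0Single_apply, if_neg fun h' => h ⟨n, h'.symm⟩]
    rfl

/-- An operator on `c₀` whose matrix is close to the identity is close to the identity. -/
theorem c0_norm_sub_one_le (A : C₀(ℕ, ℝ) →L[ℝ] C₀(ℕ, ℝ)) {r : ℝ} (hr : 0 ≤ r)
    (hdiag : ∀ k, A (c0Single k) k = 1)
    (hoff : ∀ k (F : Finset ℕ), k ∉ F → ∑ j ∈ F, |A (c0Single j) k| ≤ r) : ‖A - 1‖ ≤ r := by
  refine ContinuousLinearMap.opNorm_le_bound _ hr fun a => ?_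
  rw [c0_norm_le (by positivity)]
  intro k
  have heval : Continuous fun b : C₀(ℕ, ℝ) => b k := by
    refine continuous_iff_continuousAt.2 fun b => ?_
    rw [Metric.continuousAt_iff]
    intro ε hε
    refine ⟨ε, hε, fun {c} hc => lt_of_le_of_lt ?_ hc⟩
    rw [dist_eq_norm, dist_eq_norm]
    exact c0_abs_le (c - b) k
  have hlim := ((heval.comp (A - 1).continuous).abs.tendsto a).comp (tendsto_c0_truncate a)
  refine le_of_tendsto hlim ?_
  filter_upwards [eventually_gt_atTop k] with N hN
  have hA : ∀ F : Finset ℕ, A (∑ n ∈ F, a n • c0Single n) k =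
      ∑ n ∈ F, a n * A (c0Single n) k := by
    intro F
    induction F using Finset.cons_induction with
    | empty => simp
    | cons i F hi ih =>
      rw [Finset.sum_cons, Finset.sum_cons, ← ih, map_add, map_smul]
      rfl
  have h1 : ((A - 1) (∑ n ∈ Finset.range N, a n • c0Single n)) k =
      ∑ n ∈ (Finset.range N).erase k, a n * A (c0Single n) k := by
    have hk : k ∈ Finset.range N := Finset.mem_range.2 hN
    have h2 : ((A - 1) (∑ n ∈ Finset.range N, a n • c0Single n)) k =
        A (∑ n ∈ Finset.range N, a n • c0Single n) k -
          (∑ n ∈ Finset.range N, a n • c0Single n) k := rfl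
    rw [h2, hA, c0_sum_apply, if_pos hk, ← Finset.add_sum_erase _ _ hk, hdiag]
    ring
  simp only [Function.comp_apply, h1]
  calc |∑ n ∈ (Finset.range N).erase k, a n * A (c0Single n) k|
      ≤ ∑ n ∈ (Finset.range N).erase k, ‖a‖ * |A (c0Single n) k| := by
        refine (Finset.abs_sum_le_sum_abs _ _).trans (Finset.sum_le_sum fun n _ => ?_)
        rw [abs_mul]
        exact mul_le_mul_of_nonneg_right (c0_abs_le a n) (abs_nonneg _)
    _ ≤ r * ‖a‖ := by
        rw [← Finset.mul_sum, mul_comm]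
        exact mul_le_mul_of_nonneg_right (hoff k _ (Finset.notMem_erase _ _)) (norm_nonneg _)

/-- If an operator `R` has a left inverse up to a small perturbation, then it has a left
inverse. -/
theorem exists_leftInverse_of_norm_comp_sub_one_lt {E X : Type*} [NormedAddCommGroup E]
    [NormedSpace ℝ E] [CompleteSpace E] [NormedAddCommGroup X] [NormedSpace ℝ X] (R : E →L[ℝ] X)
    (V : X →L[ℝ] E) (h : ‖V.comp R - 1‖ < 1) : ∃ W : X →L[ℝ] E, ∀ a, W (R a) = a := by
  have h0 : ‖1 - V.comp R‖ < 1 := by rwa [norm_sub_rev]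
  -- Neumann series.
  have h1 : IsUnit (1 - (1 - V.comp R)) := isUnit_one_sub_of_norm_lt_one h0
  rw [_root_.sub_sub_cancel] at h1
  obtain ⟨u, hu⟩ := h1
  have hB : (↑u⁻¹ : E →L[ℝ] E) * V.comp R = 1 := by rw [← hu, Units.inv_mul]
  exact ⟨(↑u⁻¹ : E →L[ℝ] E).comp V, fun a => congrArg (fun f => f a) hB⟩

theorem isCopyOfC0_range_and_closedComplemented {X : Type} [NormedAddCommGroup X]
    [NormedSpace ℝ X] (R : C₀(ℕ, ℝ) →L[ℝ] X) (W : X →L[ℝ] C₀(ℕ, ℝ)) (hW : ∀ a, W (R a) = a) :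
    IsCopyOfC0 (LinearMap.range R.toLinearMap) ∧
      (LinearMap.range R.toLinearMap).ClosedComplemented := by
  let R' : C₀(ℕ, ℝ) →L[ℝ] LinearMap.range R.toLinearMap := R.codRestrict _ fun a => ⟨a, rfl⟩
  refine ⟨⟨ContinuousLinearEquiv.equivOfInverse R' (W.comp (Submodule.subtypeL _))
    (fun a => hW a) ?_⟩, R'.comp W, ?_⟩
  · rintro ⟨_, a, rfl⟩
    exact Subtype.ext (congrArg R (hW a))
  · rintro ⟨_, a, rfl⟩
    exact Subtype.ext (congrArg R (hW a))

/-! ### Sequentially compact spaces -/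

/-- The values at a point of the images of the unit vectors are absolutely summable. -/
theorem summable_abs_apply {K : Type} [TopologicalSpace K] [CompactSpace K]
    (T : C₀(ℕ, ℝ) →L[ℝ] C(K, ℝ)) (p : K) : Summable fun n => |T (c0Single n) p| := by
  refine summable_of_sum_le (c := ‖T‖) (fun n => abs_nonneg _) fun F => ?_
  -- Signs that make every term positive at `p`; the signed sum of unit vectors still has norm at
  -- most 1.
  let w : ℕ → ℝ := fun n => if 0 ≤ T (c0Single n) p then 1 else -1
  have hw : ∀ n, |w n| = 1 := fun n => by simp only [w]; split_ifs <;> simp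
  have hw' : ∀ n, w n * T (c0Single n) p = |T (c0Single n) p| := fun n => by
    simp only [w]
    split_ifs with h
    · rw [one_mul, abs_of_nonneg h]
    · rw [neg_one_mul, abs_of_neg (not_le.1 h)]
  have ha : ‖∑ n ∈ F, w n • c0Single n‖ ≤ 1 := by
    rw [c0_norm_le zero_le_one]
    intro m
    rw [c0_sum_apply]
    split_ifs
    · exact (hw m).le
    · simp
  calc ∑ n ∈ F, |T (c0Single n) p| = T (∑ n ∈ F, w n • c0Single n) p := by
        rw [map_sum, ContinuousMap.sum_apply]
        refine Finset.sum_congr rfl fun n _ => ?_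
        rw [map_smul, ← hw']
        rfl
    _ ≤ ‖T (∑ n ∈ F, w n • c0Single n)‖ :=
        (le_abs_self _).trans ((T (∑ n ∈ F, w n • c0Single n)).norm_coe_le_norm p)
    _ ≤ ‖T‖ := by
        refine (T.le_opNorm _).trans ?_
        exact mul_le_of_le_one_right (norm_nonneg _) ha

/-- A subsequence along which an infinite matrix with null columns and absolutely summable rows
is nearly diagonal. -/
theorem exists_subseq_nearly_diagonal (c : ℕ → ℕ → ℝ)
    (hcol : ∀ m, Tendsto (fun n => c n m) atTop (𝓝 0))
    (hrow : ∀ n, Summable fun m => |c n m|) {P : ℕ → Prop} (hP : ∀ᶠ n in atTop, P n)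
    {η : ℝ} (hη : 0 < η) :
    ∃ φ : ℕ → ℕ, StrictMono φ ∧ (∀ n, P (φ n)) ∧
      ∀ k (F : Finset ℕ), k ∉ F → ∑ j ∈ F, |c (φ k) (φ j)| ≤ 3 * η := by
  -- Greedy choice: each new index comes so late that the earlier columns are tiny there and the
  -- earlier rows have tiny tails.
  obtain ⟨φ, hφP, hφ⟩ := exists_seq_of_forall_finset_exists P
    (fun x y => x < y ∧ |c y x| ≤ η * (1 / 2) ^ x ∧ ∑' m, |c x (m + y)| ≤ η) (by
      intro s _
      have h1 : ∀ᶠ y in atTop, ∀ x ∈ s,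
          x < y ∧ |c y x| ≤ η * (1 / 2) ^ x ∧ ∑' m, |c x (m + y)| ≤ η := by
        rw [Filter.eventually_all_finset]
        intro x _
        have h2 := (hcol x).abs
        rw [abs_zero] at h2
        have h3 := tendsto_sum_nat_add fun m => |c x m|
        filter_upwards [eventually_gt_atTop x,
          h2.eventually_lt_const (show 0 < η * (1 / 2) ^ x by positivity),
          h3.eventually_lt_const hη] with y hy1 hy2 hy3
        exact ⟨hy1, hy2.le, hy3.le⟩
      exact (hP.and h1).exists)
  have hmono : StrictMono φ := fun a b hab => (hφ a b hab).1
  refine ⟨φ, hmono, hφP, fun k F hk => ?_⟩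
  -- Entries left of the diagonal add up to at most `∑ η / 2 ^ j = 2η`, those right of it lie in a
  -- row tail of size at most `η`.
  rw [← Finset.sum_filter_add_sum_filter_not F (fun j => j < k)]
  have hlow : ∑ j ∈ F.filter (fun j => j < k), |c (φ k) (φ j)| ≤ 2 * η := by
    calc ∑ j ∈ F.filter (fun j => j < k), |c (φ k) (φ j)|
        ≤ ∑ j ∈ F.filter (fun j => j < k), η * (1 / 2) ^ j := by
          refine Finset.sum_le_sum fun j hj => (hφ j k (Finset.mem_filter.1 hj).2).2.1.trans ?_
          exact mul_le_mul_of_nonneg_left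
            (pow_le_pow_of_le_one (by norm_num) (by norm_num) (hmono.id_le j)) hη.le
      _ = η * ∑ j ∈ F.filter (fun j => j < k), (1 / 2 : ℝ) ^ j := by rw [Finset.mul_sum]
      _ ≤ η * 2 := by
          refine mul_le_mul_of_nonneg_left ?_ hη.le
          refine le_trans ?_ tsum_geometric_two.le
          exact summable_geometric_two.sum_le_tsum _ fun j _ => by positivity
      _ = 2 * η := mul_comm _ _
  have hhigh : ∑ j ∈ F.filter (fun j => ¬ j < k), |c (φ k) (φ j)| ≤ η := by
    refine le_trans ?_ (hφ k (k + 1) (Nat.lt_succ_self k)).2.2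
    have hle : ∀ j ∈ F.filter (fun j => ¬ j < k), φ (k + 1) ≤ φ j := by
      intro j hj
      have h1 := Finset.mem_filter.1 hj
      have h2 : j ≠ k := fun h => hk (h ▸ h1.1)
      exact hmono.monotone (by omega)
    have hinj : Set.InjOn (fun j => φ j - φ (k + 1)) (F.filter (fun j => ¬ j < k)) := by
      intro i hi j hj hij
      have h1 := hle i hi
      have h2 := hle j hj
      have h3 : φ i - φ (k + 1) = φ j - φ (k + 1) := hij
      exact hmono.injective (by omega)
    have hs : Summable fun m => |c (φ k) (m + φ (k + 1))| :=
      (summable_nat_add_iff (f := fun m => |c (φ k) m|) _).2 (hrow _)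
    refine le_trans (le_of_eq ?_) (hs.sum_le_tsum
      ((F.filter (fun j => ¬ j < k)).image fun j => φ j - φ (k + 1)) fun _ _ => abs_nonneg _)
    rw [Finset.sum_image hinj]
    exact Finset.sum_congr rfl fun j hj => by rw [Nat.sub_add_cancel (hle j hj)]
  linarith

/-- Choose points `xₙ` where the images of the unit vectors are large, and a subsequence converging
to `p`. The functionals `f ↦ f(xₙ) - f(p)` are pointwise null, so they map into `c₀`. After thinning
out and normalising they almost invert the embedding of a subcopy of `c₀`. -/
theorem hereditarilySeparablySobczyk_of_seqCompactSpace (K : Type) [TopologicalSpace K]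
    [CompactSpace K] [SeqCompactSpace K] : HereditarilySeparablySobczyk C(K, ℝ) := by
  rintro Y ⟨T⟩
  let T' : C₀(ℕ, ℝ) →L[ℝ] C(K, ℝ) := Y.subtypeL.comp (T : C₀(ℕ, ℝ) →L[ℝ] Y)
  obtain ⟨M, hM, hTM⟩ : ∃ M : ℝ, 0 < M ∧ ∀ a, ‖a‖ ≤ M * ‖T' a‖ := by
    refine ⟨‖(T.symm : Y →L[ℝ] C₀(ℕ, ℝ))‖ + 1, by positivity, fun a => ?_⟩
    have h1 := (T.symm : Y →L[ℝ] C₀(ℕ, ℝ)).le_opNorm (T a)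
    have h2 : (T.symm : Y →L[ℝ] C₀(ℕ, ℝ)) (T a) = a := T.symm_apply_apply a
    rw [h2] at h1
    refine h1.trans (mul_le_mul_of_nonneg_right ?_ (norm_nonneg _))
    linarith
  have hx : ∀ n, ∃ x, 1 / (2 * M) < |T' (c0Single n) x| := by
    intro n
    by_contra! h
    have h1 : ‖T' (c0Single n)‖ ≤ 1 / (2 * M) :=
      (ContinuousMap.norm_le _ (by positivity)).2 h
    have h2 : (1 : ℝ) ≤ ‖c0Single n‖ := by
      simpa [c0Single_apply] using c0_abs_le (c0Single n) n
    have h3 := h2.trans ((hTM _).trans (mul_le_mul_of_nonneg_left h1 hM.le))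
    have h4 : M * (1 / (2 * M)) = 1 / 2 := by field_simp
    rw [h4] at h3
    norm_num at h3
  choose x hx using hx
  obtain ⟨p, φ₀, hφ₀, hp⟩ := SeqCompactSpace.tendsto_subseq x
  -- Half the lower bound for the values at `xₙ`; the other half absorbs the values at `p`, which
  -- tend to zero.
  set δ : ℝ := 1 / (4 * M) with hδ
  have hδ0 : 0 < δ := by positivity
  let g : ℕ → C(K, ℝ) := fun n => T' (c0Single (φ₀ n))
  have hgs : ∀ q, Summable fun n => |g n q| := fun q =>
    (summable_abs_apply T' q).comp_injective hφ₀.injective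
  let c : ℕ → ℕ → ℝ := fun n m => g m (x (φ₀ n)) - g m p
  have hcol : ∀ f : C(K, ℝ), Tendsto (fun n => f (x (φ₀ n)) - f p) atTop (𝓝 0) := by
    intro f
    rw [← _root_.sub_self (f p)]
    exact ((f.continuous.tendsto p).comp hp).sub_const _
  have hrow : ∀ n, Summable fun m => |c n m| := fun n =>
    Summable.of_nonneg_of_le (fun _ => abs_nonneg _) (fun m => abs_sub _ _)
      ((hgs (x (φ₀ n))).add (hgs p))
  have hdiag : ∀ᶠ n in atTop, δ ≤ |c n n| := by
    filter_upwards [(hgs p).tendsto_atTop_zero.eventually_lt_const hδ0] with n hn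
    have h1 : 2 * δ < |g n (x (φ₀ n))| := by
      have h2 : 2 * δ = 1 / (2 * M) := by rw [hδ]; field_simp; norm_num
      rw [h2]
      exact hx (φ₀ n)
    have h2 := abs_sub_abs_le_abs_sub (g n (x (φ₀ n))) (g n p)
    show δ ≤ |g n (x (φ₀ n)) - g n p|
    linarith
  -- With `η = δ / 6` the off-diagonal rows sum to at most `δ / 2`, so dividing by diagonal entries
  -- of size at least `δ` leaves an error of at most 1/2.
  obtain ⟨φ, hφ, hφd, hφs⟩ := exists_subseq_nearly_diagonal c (fun m => hcol (g m)) hrow hdiag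
    (η := δ / 6) (by positivity)
  let R : C₀(ℕ, ℝ) →L[ℝ] C(K, ℝ) := T'.comp (c0Reindex (φ₀ ∘ φ) (hφ₀.comp hφ))
  have hR : ∀ j, R (c0Single j) = g (φ j) := by
    intro j
    show T' (c0Reindex _ _ (c0Single j)) = _
    rw [c0Reindex_single]
    rfl
  let d : ℕ → ℝ := fun k => c (φ k) (φ k)
  have hd0 : ∀ k, d k ≠ 0 := fun k h => by
    have h1 := hφd k
    rw [show c (φ k) (φ k) = 0 from h, abs_zero] at h1
    linarith
  have hV : ∀ f : C(K, ℝ), Tendsto (fun k => (f (x (φ₀ (φ k))) - f p) / d k) atTop (𝓝 0) := by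
    intro f
    have h1 : Tendsto (fun k => |f (x (φ₀ (φ k))) - f p| / δ) atTop (𝓝 0) := by
      have h2 := (((hcol f).comp hφ.tendsto_atTop).abs).div_const δ
      rwa [abs_zero, _root_.zero_div] at h2
    refine squeeze_zero_norm (fun k => ?_) h1
    rw [norm_div, Real.norm_eq_abs, Real.norm_eq_abs]
    exact div_le_div_of_nonneg_left (abs_nonneg _) hδ0 (hφd k)
  let V : C(K, ℝ) →L[ℝ] C₀(ℕ, ℝ) := LinearMap.mkContinuous
    { toFun := fun f => nullSeq _ (hV f)
      map_add' := fun f h => by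
        ext k
        show ((f + h) (x (φ₀ (φ k))) - (f + h) p) / d k =
          (f (x (φ₀ (φ k))) - f p) / d k + (h (x (φ₀ (φ k))) - h p) / d k
        simp only [ContinuousMap.add_apply]
        ring
      map_smul' := fun r f => by
        ext k
        show ((r • f) (x (φ₀ (φ k))) - (r • f) p) / d k = r * ((f (x (φ₀ (φ k))) - f p) / d k)
        simp only [ContinuousMap.smul_apply, _root_.smul_eq_mul]
        ring } (2 / δ) fun f => by
      rw [c0_norm_le (by positivity)]
      intro k
      show |(f (x (φ₀ (φ k))) - f p) / d k| ≤ 2 / δ * ‖f‖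
      rw [abs_div, div_mul_eq_mul_div]
      have h1 := f.norm_coe_le_norm (x (φ₀ (φ k)))
      have h2 := f.norm_coe_le_norm p
      rw [Real.norm_eq_abs] at h1 h2
      refine div_le_div₀ (by positivity) ((abs_sub _ _).trans (by linarith)) hδ0 (hφd k)
  have hVR : ∀ j k, V.comp R (c0Single j) k = c (φ k) (φ j) / d k := by
    intro j k
    show (R (c0Single j) (x (φ₀ (φ k))) - R (c0Single j) p) / d k = _
    rw [hR]
  have hnear : ‖V.comp R - 1‖ ≤ 1 / 2 := by
    refine c0_norm_sub_one_le _ (by norm_num) (fun k => ?_) fun k F hk => ?_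
    · rw [hVR]
      exact div_self (hd0 k)
    · simp only [hVR, abs_div]
      rw [← Finset.sum_div, div_le_iff₀ (abs_pos.2 (hd0 k))]
      have h1 := hφs k F hk
      have h2 : δ ≤ |d k| := hφd k
      linarith
  obtain ⟨W, hW⟩ := exists_leftInverse_of_norm_comp_sub_one_lt R V (by linarith)
  obtain ⟨h1, h2⟩ := isCopyOfC0_range_and_closedComplemented R W hW
  refine ⟨_, ?_, h1, h2⟩
  rintro _ ⟨a, rfl⟩
  exact (T _).2

/-! ### Positive functionals on a chain compactification are separable -/

section PositiveFunctional

variable {X : Type*} [TopologicalSpace X] {Φ : C(X, ℝ) →ₗ[ℝ] ℝ}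

theorem functional_mono (hΦ : ∀ f, 0 ≤ f → 0 ≤ Φ f) {f g : C(X, ℝ)} (h : ∀ x, f x ≤ g x) :
    Φ f ≤ Φ g := by
  have h1 := hΦ (g - f) fun x => by simpa using h x
  rw [map_sub] at h1
  linarith

theorem functional_abs_sub_le (hΦ : ∀ f, 0 ≤ f → 0 ≤ Φ f) (f g h : C(X, ℝ)) :
    Φ |f - h| ≤ Φ |f - g| + Φ |g - h| := by
  rw [← map_add]
  exact functional_mono hΦ fun x => by simpa using abs_sub_le (f x) (g x) (h x)

theorem functional_abs_le [CompactSpace X] (hΦ : ∀ f, 0 ≤ f → 0 ≤ Φ f) (f : C(X, ℝ)) :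
    Φ |f| ≤ ‖f‖ * Φ 1 := by
  rw [← _root_.smul_eq_mul, ← map_smul]
  exact functional_mono hΦ fun x => by simpa using f.norm_coe_le_norm x

theorem functional_one_nonneg (hΦ : ∀ f, 0 ≤ f → 0 ≤ Φ f) : 0 ≤ Φ 1 :=
  hΦ 1 fun _ => zero_le_one

/-- Functions that factor through `r` up to a small error for the seminorm given by `Φ`. -/
def ApproxThrough {Z : Type*} [TopologicalSpace Z] (Φ : C(X, ℝ) →ₗ[ℝ] ℝ) (r : C(X, Z))
    (f : C(X, ℝ)) : Prop :=
  ∀ ε > 0, ∃ h : C(Z, ℝ), Φ |f - h.comp r| < ε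

variable {Z : Type*} [TopologicalSpace Z] {r : C(X, Z)}

theorem ApproxThrough.comp (h : C(Z, ℝ)) : ApproxThrough Φ r (h.comp r) := by
  intro ε hε
  exact ⟨h, by simpa using hε⟩

theorem ApproxThrough.add (hΦ : ∀ f, 0 ≤ f → 0 ≤ Φ f) {f g : C(X, ℝ)}
    (hf : ApproxThrough Φ r f) (hg : ApproxThrough Φ r g) : ApproxThrough Φ r (f + g) := by
  intro ε hε
  obtain ⟨h, hh⟩ := hf (ε / 2) (half_pos hε)
  obtain ⟨k, hk⟩ := hg (ε / 2) (half_pos hε)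
  refine ⟨h + k, ?_⟩
  have h1 : Φ |f + g - (h + k).comp r| ≤ Φ |f - h.comp r| + Φ |g - k.comp r| := by
    rw [← map_add]
    refine functional_mono hΦ fun x => ?_
    simp only [ContinuousMap.abs_apply, ContinuousMap.sub_apply, ContinuousMap.add_apply,
      ContinuousMap.comp_apply]
    refine le_trans (le_of_eq ?_) (abs_add_le _ _)
    ring_nf
  linarith

theorem ApproxThrough.mul [CompactSpace X] (hΦ : ∀ f, 0 ≤ f → 0 ≤ Φ f) {f g : C(X, ℝ)}
    (hf : ApproxThrough Φ r f) (hg : ApproxThrough Φ r g) : ApproxThrough Φ r (f * g) := by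
  intro ε hε
  obtain ⟨h, hh⟩ := hf (ε / 2 / (‖g‖ + 1)) (by positivity)
  -- The second tolerance depends on the first approximant `h`, whose norm is not controlled by that
  -- of `f`.
  obtain ⟨k, hk⟩ := hg (ε / 2 / (‖h.comp r‖ + 1)) (by positivity)
  refine ⟨h * k, ?_⟩
  rw [lt_div_iff₀ (by positivity)] at hh hk
  have h1 : Φ |f * g - (h * k).comp r| ≤
      (‖g‖ + 1) * Φ |f - h.comp r| + (‖h.comp r‖ + 1) * Φ |g - k.comp r| := by
    rw [← _root_.smul_eq_mul (‖g‖ + 1), ← _root_.smul_eq_mul (‖h.comp r‖ + 1), ← map_smul,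
      ← map_smul, ← map_add]
    refine functional_mono hΦ fun x => ?_
    have h2 := g.norm_coe_le_norm x
    have h3 := (h.comp r).norm_coe_le_norm x
    rw [Real.norm_eq_abs] at h2 h3
    simp only [ContinuousMap.abs_apply, ContinuousMap.sub_apply, ContinuousMap.add_apply,
      ContinuousMap.mul_apply, ContinuousMap.smul_apply, ContinuousMap.comp_apply,
      _root_.smul_eq_mul] at h3 ⊢
    have h4 : f x * g x - h (r x) * k (r x) =
        g x * (f x - h (r x)) + h (r x) * (g x - k (r x)) := by ring
    rw [h4]
    refine (abs_add_le _ _).trans ?_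
    rw [abs_mul, abs_mul]
    gcongr <;> linarith
  linarith

theorem ApproxThrough.of_limit [CompactSpace X] (hΦ : ∀ f, 0 ≤ f → 0 ≤ Φ f) {f : C(X, ℝ)}
    (hf : ∀ ε > 0, ∃ g, ApproxThrough Φ r g ∧ ‖f - g‖ < ε) : ApproxThrough Φ r f := by
  intro ε hε
  have h1 := functional_one_nonneg hΦ
  obtain ⟨g, hg, hfg⟩ := hf (ε / 2 / (Φ 1 + 1)) (by positivity)
  obtain ⟨h, hh⟩ := hg (ε / 2) (half_pos hε)
  refine ⟨h, (functional_abs_sub_le hΦ f g _).trans_lt ?_⟩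
  rw [lt_div_iff₀ (by positivity)] at hfg
  have h2 := functional_abs_le hΦ (f - g)
  nlinarith [norm_nonneg (f - g)]

/-- If all functions approximately factor through a compact metrizable space, then the seminorm
given by `Φ` is separable. -/
theorem exists_countable_of_approxThrough [CompactSpace X]
    (hΦ : ∀ f, 0 ≤ f → 0 ≤ Φ f) [CompactSpace Z] [T2Space Z] [SecondCountableTopology Z]
    (h : ∀ f, ApproxThrough Φ r f) :
    ∃ D : Set C(X, ℝ), D.Countable ∧ ∀ f, ∀ ε > 0, ∃ d ∈ D, Φ |f - d| < ε := by
  obtain ⟨E, hE, hEd⟩ := TopologicalSpace.exists_countable_dense C(Z, ℝ)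
  refine ⟨(fun h : C(Z, ℝ) => h.comp r) '' E, hE.image _, fun f ε hε => ?_⟩
  have h1 := functional_one_nonneg hΦ
  obtain ⟨k, hk⟩ := h f (ε / 2) (half_pos hε)
  obtain ⟨d, hd, hkd⟩ := Metric.mem_closure_iff.1 (hEd k) (ε / 2 / (Φ 1 + 1)) (by positivity)
  refine ⟨_, ⟨d, hd, rfl⟩, (functional_abs_sub_le hΦ f (k.comp r) _).trans_lt ?_⟩
  rw [lt_div_iff₀ (by positivity), dist_eq_norm] at hkd
  have h2 := functional_abs_le hΦ (k.comp r - d.comp r)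
  have h3 : ‖k.comp r - d.comp r‖ ≤ ‖k - d‖ :=
    (ContinuousMap.norm_le _ (norm_nonneg _)).2 fun x => (k - d).norm_coe_le_norm (r x)
  nlinarith [norm_nonneg (k - d), norm_nonneg (k.comp r - d.comp r)]

end PositiveFunctional

theorem coord_avoid_le_of_subset {a b : κ} {m : ℕ} (hab : ∀ n, m ≤ n → S a n ⊆ S b n)
    (p : Space S) : coord S (.avoid b m) p ≤ coord S (.avoid a m) p := by
  simp only [coord_apply]
  split_ifs with h1 h2 h2
  · exact le_rfl
  · exact absurd (avoid_of_subset h1 hab) h2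
  · exact zero_le_one
  · exact le_rfl

theorem coord_avoid_mono (a : κ) {m m' : ℕ} (hm : m ≤ m') (p : Space S) :
    coord S (.avoid a m) p ≤ coord S (.avoid a m') p := by
  simp only [coord_apply]
  split_ifs with h1 h2 h2
  · exact le_rfl
  · exact absurd (avoid_mono h1 hm) h2
  · exact zero_le_one
  · exact le_rfl

theorem coord_avoid_eq_mul (a : κ) {m m' : ℕ} (hm : m ≤ m') (p : Space S) :
    coord S (.avoid a m) p = coord S (.avoid a m') p *
      ∏ j ∈ Finset.Ico m m', ∏ i ∈ S a j, (1 - coord S (.digit j i) p) := by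
  by_cases h : p.1 (.avoid a m') = true
  · have h0 : coord S (.avoid a m') p = 1 := if_pos h
    rw [h0, one_mul]
    by_cases h1 : ∀ j ∈ Finset.Ico m m', ∀ i ∈ S a j, p.1 (.digit j i) = false
    · rw [coord_apply, if_pos ((avoid_iff_of_avoid h).2 h1), Finset.prod_eq_one]
      intro j hj
      refine Finset.prod_eq_one fun i hi => ?_
      simp [coord_apply, h1 j hj i hi]
    · rw [coord_apply, if_neg fun h2 => h1 ((avoid_iff_of_avoid h).1 h2)]
      push Not at h1
      obtain ⟨j, hj, i, hi, hji⟩ := h1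
      refine (Finset.prod_eq_zero hj (Finset.prod_eq_zero hi ?_)).symm
      simp [coord_apply, hji]
  · have h0 : coord S (.avoid a m') p = 0 := if_neg h
    rw [h0, zero_mul]
    exact if_neg fun h1 => h (avoid_mono h1 hm)

theorem exists_countable_dense_values {ι : Type*} (u : ι → ℝ) :
    ∃ J : Set ι, J.Countable ∧ ∀ a, ∀ ε > 0, ∃ b ∈ J, |u a - u b| < ε := by
  obtain ⟨E, hE, hEd⟩ := TopologicalSpace.exists_countable_dense (Set.range u)
  choose f hf using fun x : Set.range u => x.2
  refine ⟨f '' E, hE.image f, fun a ε hε => ?_⟩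
  obtain ⟨x, hx, hax⟩ := Metric.mem_closure_iff.1 (hEd ⟨u a, a, rfl⟩) ε hε
  refine ⟨f x, ⟨x, hx, rfl⟩, ?_⟩
  rw [hf]
  exact hax

/-- Eventually, the coordinates of two members of a chain with close limits are close. -/
theorem eventually_functional_avoid_sub_lt [LinearOrder κ]
    (hS : ∀ a b, a ≤ b → (S a).AELe (S b)) {Φ : C(Space S, ℝ) →ₗ[ℝ] ℝ}
    {u : κ → ℝ}
    (hu : ∀ a, Tendsto (fun m => Φ (coord S (.avoid a m))) atTop (𝓝 (u a))) {a b : κ} {ε : ℝ}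
    (h : |u a - u b| < ε) :
    ∀ᶠ m in atTop, Φ |coord S (.avoid a m) - coord S (.avoid b m)| < ε := by
  wlog hab : a ≤ b generalizing a b
  · rw [abs_sub_comm] at h
    filter_upwards [this h (not_le.1 hab).le] with m hm
    rwa [abs_sub_comm]
  obtain ⟨k, hk⟩ := eventually_atTop.1 (hS a b hab)
  filter_upwards [((hu a).sub (hu b)).abs.eventually_lt_const h, eventually_ge_atTop k]
    with m h1 h2
  have h3 : |coord S (.avoid a m) - coord S (.avoid b m)| =
      coord S (.avoid a m) - coord S (.avoid b m) := by
    refine abs_of_nonneg fun p => ?_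
    simpa using coord_avoid_le_of_subset (fun n hn => hk n (h2.trans hn)) p
  rw [h3, map_sub]
  exact (le_abs_self _).trans_lt h1

/-- Let `u a` be the limit of `Φ` on the avoidance labels of `a`. Along the chain these labels are
eventually nested, so their distance is a difference of values of `Φ` and tends to `|u a - u b|`.
Countably many slaloms with dense values `u` therefore suffice, together with the countably many
nodes and digits. -/
theorem exists_countable_dense_of_chain [LinearOrder κ]
    (hS : ∀ a b, a ≤ b → (S a).AELe (S b)) {Φ : C(Space S, ℝ) →ₗ[ℝ] ℝ}
    (hΦ : ∀ f, 0 ≤ f → 0 ≤ Φ f) :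
    ∃ D : Set C(Space S, ℝ), D.Countable ∧ ∀ f, ∀ ε > 0, ∃ d ∈ D, Φ |f - d| < ε := by
  have hlim : ∀ a, ∃ c, Tendsto (fun m => Φ (coord S (.avoid a m))) atTop (𝓝 c) := fun a =>
    ⟨_, tendsto_atTop_ciSup (fun m m' hm => functional_mono hΦ (coord_avoid_mono a hm))
      ⟨Φ 1, by rintro _ ⟨m, rfl⟩; exact functional_mono hΦ (coord_le_one _)⟩⟩
  choose u hu using hlim
  obtain ⟨J, hJ, hJd⟩ := exists_countable_dense_values u
  let I₀ : Set (Label κ) := Set.range Label.node ∪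
    Set.range (fun d : Σ n : ℕ, Fin (2 ^ n) => Label.digit d.1 d.2) ∪
    ⋃ b ∈ J, Set.range (Label.avoid b)
  have hI₀ : I₀.Countable := ((Set.countable_range _).union (Set.countable_range _)).union
    (hJ.biUnion fun b _ => Set.countable_range _)
  have : Countable I₀ := hI₀.to_subtype
  let r : C(Space S, I₀ → Bool) := ⟨fun p l => p.1 l, by
    exact continuous_pi fun l => (continuous_apply l.1).comp continuous_subtype_val⟩
  let hc : I₀ → C(I₀ → Bool, ℝ) := fun l =>
    ⟨fun z => if z l = true then 1 else 0, (continuous_of_discreteTopology (f := fun b : Bool =>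
      if b = true then (1 : ℝ) else 0)).comp (continuous_apply l)⟩
  have hcr : ∀ l : I₀, (hc l).comp r = coord S l.1 := fun l => rfl
  have hnode : ∀ t, Label.node t ∈ I₀ := fun t => Or.inl (Or.inl ⟨t, rfl⟩)
  have hdigit : ∀ n i, Label.digit n i ∈ I₀ := fun n i => Or.inl (Or.inr ⟨⟨n, i⟩, rfl⟩)
  have havoid : ∀ b ∈ J, ∀ m, Label.avoid b m ∈ I₀ := fun b hb m =>
    Or.inr (Set.mem_biUnion hb ⟨m, rfl⟩)
  refine exists_countable_of_approxThrough (r := r) hΦ fun f => ?_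
  induction f using continuousMap_induction with
  | const c => exact ApproxThrough.comp (r := r) (algebraMap ℝ _ c)
  | coord l =>
    cases l with
    | node t => exact hcr ⟨_, hnode t⟩ ▸ ApproxThrough.comp (hc ⟨_, hnode t⟩)
    | digit n i => exact hcr ⟨_, hdigit n i⟩ ▸ ApproxThrough.comp (hc ⟨_, hdigit n i⟩)
    | avoid a m =>
      intro ε hε
      obtain ⟨b, hb, hab⟩ := hJd a ε hε
      obtain ⟨m', hm', hmm'⟩ := ((eventually_functional_avoid_sub_lt hS hu hab).and
        (eventually_ge_atTop m)).exists
      -- Replace `a` by `b` only beyond `m'`; the conditions of `a` on coordinates below `m'` are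
      -- kept exactly, as a product of digit functions bounded by 1.
      refine ⟨hc ⟨_, havoid b hb m'⟩ *
        ∏ j ∈ Finset.Ico m m', ∏ i ∈ S a j, (1 - hc ⟨_, hdigit j i⟩), lt_of_le_of_lt ?_ hm'⟩
      refine functional_mono hΦ fun p => ?_
      have h1 : (∏ j ∈ Finset.Ico m m', ∏ i ∈ S a j, (1 - hc ⟨_, hdigit j i⟩)) (r p) =
          ∏ j ∈ Finset.Ico m m', ∏ i ∈ S a j, (1 - coord S (.digit j i) p) := by
        simp only [ContinuousMap.prod_apply, ContinuousMap.sub_apply, ContinuousMap.one_apply]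
        rfl
      have h2 : hc ⟨_, havoid b hb m'⟩ (r p) = coord S (.avoid b m') p := rfl
      simp only [ContinuousMap.abs_apply, ContinuousMap.sub_apply, ContinuousMap.comp_apply,
        ContinuousMap.mul_apply, h1, h2, coord_avoid_eq_mul a hmm']
      set w := ∏ j ∈ Finset.Ico m m', ∏ i ∈ S a j, (1 - coord S (.digit j i) p)
      have h01 : ∀ j i, 0 ≤ 1 - coord S (.digit j i) p ∧ 1 - coord S (.digit j i) p ≤ 1 :=
        fun j i => ⟨by linarith [coord_le_one (.digit j i) p],
          by linarith [coord_nonneg (.digit j i) p]⟩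
      have hw0 : 0 ≤ w := Finset.prod_nonneg fun j _ => Finset.prod_nonneg fun i _ => (h01 j i).1
      have hw1 : w ≤ 1 := Finset.prod_le_one
        (fun j _ => Finset.prod_nonneg fun i _ => (h01 j i).1)
        fun j _ => Finset.prod_le_one (fun i _ => (h01 j i).1) fun i _ => (h01 j i).2
      rw [← sub_mul, abs_mul, abs_of_nonneg hw0]
      exact mul_le_of_le_one_right (abs_nonneg _) hw1
  | add f g hf hg => exact hf.add hΦ hg
  | mul f g hf hg => exact hf.mul hΦ hg
  | lim f hf => exact ApproxThrough.of_limit hΦ hf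

/-! ### Maps onto cubes -/

/-- The average of a function over the points `y B` with `B` ranging over subsets of `F`. -/
noncomputable def cubeAverage {X J : Type*} [TopologicalSpace X] (y : Finset J → X)
    (F : Finset J) (g : C(X, ℝ)) : ℝ :=
  (∑ B ∈ F.powerset, g (y B)) / 2 ^ F.card

theorem abs_cubeAverage_le {X J : Type*} [TopologicalSpace X] [CompactSpace X] (y : Finset J → X)
    (F : Finset J) (g : C(X, ℝ)) : |cubeAverage y F g| ≤ ‖g‖ := by
  rw [cubeAverage, abs_div, abs_of_pos (by positivity : (0 : ℝ) < 2 ^ F.card),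
    div_le_iff₀ (by positivity)]
  refine (Finset.abs_sum_le_sum_abs _ _).trans ?_
  refine (Finset.sum_le_sum fun B _ => g.norm_coe_le_norm (y B)).trans (le_of_eq ?_)
  rw [Finset.sum_const, Finset.card_powerset, _root_.nsmul_eq_mul, mul_comm]
  push_cast
  rfl

/-- Toggling the membership of `ξ` swaps the values 0 and 1 of `|f - g|`, so exactly half the
vertices contribute. -/
theorem cubeAverage_abs_sub {X J : Type*} [TopologicalSpace X] [DecidableEq J]
    (y : Finset J → X) {F : Finset J} {ξ η : J} (hξ : ξ ∈ F) (hξη : ξ ≠ η) {f g : C(X, ℝ)}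
    (hf : ∀ B, f (y B) = if ξ ∈ B then 1 else 0) (hg : ∀ B, g (y B) = if η ∈ B then 1 else 0) :
    cubeAverage y F |f - g| = 1 / 2 := by
  have h1 : ∑ B ∈ F.powerset, |f - g| (y B) = ∑ B ∈ F.powerset, |f - g| (y (symmDiff B {ξ})) := by
    refine Finset.sum_nbij' (fun B => symmDiff B {ξ}) (fun B => symmDiff B {ξ}) ?_ ?_ ?_ ?_ ?_
    · intro B hB
      rw [Finset.mem_powerset] at hB ⊢
      intro x hx
      rcases Finset.mem_symmDiff.1 hx with h | h
      · exact hB h.1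
      · rwa [Finset.mem_singleton.1 h.1]
    · intro B hB
      rw [Finset.mem_powerset] at hB ⊢
      intro x hx
      rcases Finset.mem_symmDiff.1 hx with h | h
      · exact hB h.1
      · rwa [Finset.mem_singleton.1 h.1]
    · intro B _; simp
    · intro B _; simp
    · intro B _; simp
  have h2 : ∀ B, |f - g| (y B) + |f - g| (y (symmDiff B {ξ})) = 1 := by
    intro B
    simp only [ContinuousMap.abs_apply, ContinuousMap.sub_apply, hf, hg, Finset.mem_symmDiff,
      Finset.mem_singleton]
    by_cases h3 : ξ ∈ B <;> by_cases h4 : η ∈ B <;> simp [h3, h4, hξη.symm]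
  have h3 : 2 * ∑ B ∈ F.powerset, |f - g| (y B) = 2 ^ F.card := by
    rw [two_mul]
    nth_rewrite 2 [h1]
    rw [← Finset.sum_add_distrib, Finset.sum_congr rfl fun B _ => h2 B]
    simp
  rw [cubeAverage, _root_.div_eq_iff (by positivity)]
  linarith

/-- An ultralimit of averages over the vertices of finite faces of a cube. -/
theorem exists_functional_of_cube {X J : Type*} [TopologicalSpace X] [CompactSpace X]
    [DecidableEq J] (y : Finset J → X) (f : J → C(X, ℝ))
    (hf : ∀ ξ B, f ξ (y B) = if ξ ∈ B then 1 else 0) :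
    ∃ Φ : C(X, ℝ) →ₗ[ℝ] ℝ, (∀ g, 0 ≤ g → 0 ≤ Φ g) ∧
      ∀ ξ η, ξ ≠ η → Φ |f ξ - f η| = 1 / 2 := by
  -- Refining `atTop` ensures that each index eventually belongs to the face, so the averages are
  -- eventually exactly 1/2.
  let U : Ultrafilter (Finset J) := Ultrafilter.of atTop
  have hU : (U : Filter (Finset J)) ≤ atTop := Ultrafilter.of_le _
  have hlim : ∀ g : C(X, ℝ), ∃ c, Tendsto (fun F => cubeAverage y F g) U (𝓝 c) := by
    intro g
    obtain ⟨c, _, hc⟩ := (isCompact_Icc (a := -‖g‖) (b := ‖g‖)).ultrafilter_le_nhds'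
      (U.map fun F => cubeAverage y F g)
      (Ultrafilter.mem_map.2 (univ_mem' fun F => abs_le.1 (abs_cubeAverage_le y F g)))
    exact ⟨c, hc⟩
  choose Φ hΦ using hlim
  refine ⟨{ toFun := Φ, map_add' := fun g h => ?_, map_smul' := fun c g => ?_ }, fun g hg => ?_,
    fun ξ η hξη => ?_⟩
  · refine tendsto_nhds_unique (hΦ (g + h)) (((hΦ g).add (hΦ h)).congr fun F => ?_)
    rw [cubeAverage, cubeAverage, cubeAverage, ← add_div, ← Finset.sum_add_distrib]
    rfl
  · refine tendsto_nhds_unique (hΦ (c • g)) (((hΦ g).const_mul c).congr fun F => ?_)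
    rw [cubeAverage, cubeAverage, ← mul_div_assoc, Finset.mul_sum]
    rfl
  · exact ge_of_tendsto' (hΦ g) fun F =>
      div_nonneg (Finset.sum_nonneg fun B _ => hg (y B)) (by positivity)
  · refine tendsto_nhds_unique (hΦ _) (tendsto_nhds_of_eventually_eq ?_)
    filter_upwards [hU (mem_atTop {ξ})] with F hF
    exact cubeAverage_abs_sub y (hF (Finset.mem_singleton_self ξ)) hξη (hf ξ) (hf η)

/-- Extend the coordinates of such a map to the whole space. Averaging over preimages of the
vertices puts these `ω₁` functions at mutual distance 1/2 for a positive functional, against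
separability. -/
theorem not_mapsOntoCube_growth [LinearOrder κ] (hS : ∀ a b, a ≤ b → (S a).AELe (S b)) :
    ¬ MapsOntoCube ((Set.range (emb S))ᶜ : Set (Space S)) := by
  classical
  rintro ⟨f, hf, hsurj⟩
  let J := (ω₁ : Ordinal.{0}).ToType
  choose y hy using fun B : Finset J => hsurj fun ξ => if ξ ∈ B then 1 else 0
  have hcoord : ∀ ξ : J, Continuous fun p => ((f p ξ : unitInterval) : ℝ) := fun ξ =>
    continuous_subtype_val.comp ((continuous_apply ξ).comp hf)
  choose g hg using fun ξ : J => exists_extension_growth ⟨_, hcoord ξ⟩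
  obtain ⟨Φ, hΦ, hsep⟩ := exists_functional_of_cube (fun B => (y B : Space S)) g (by
    intro ξ B
    rw [hg]
    simp only [ContinuousMap.coe_mk, hy]
    split_ifs <;> rfl)
  obtain ⟨D, hD, hDd⟩ := exists_countable_dense_of_chain hS hΦ
  -- Two functions sharing an approximant within 1/4 would be at distance less than 1/2.
  choose d hd hgd using fun ξ => hDd (g ξ) (1 / 4) (by norm_num)
  have hinj : Function.Injective fun ξ => (⟨d ξ, hd ξ⟩ : D) := by
    intro ξ η h
    have h1 : d ξ = d η := congrArg Subtype.val h
    by_contra hne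
    have h2 := functional_abs_sub_le hΦ (g ξ) (d ξ) (g η)
    rw [hsep ξ η hne, h1, abs_sub_comm (d η)] at h2
    have h3 := hgd ξ
    rw [h1] at h3
    linarith [hgd η]
  have : Countable D := hD.to_subtype
  have hJ : Countable J := hinj.countable
  rw [← mk_le_aleph0_iff, mk_toType, card_omega] at hJ
  exact absurd hJ (not_le.2 aleph0_lt_aleph_one)

theorem growth_emb_comp {κ : Type} (S : κ → Slalom) (q : ℕ ≃ Node) :
    growth (emb S ∘ q) = (Set.range (emb S))ᶜ := by
  rw [growth, EquivLike.range_comp]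

theorem nonempty_equiv_node : Nonempty (ℕ ≃ Node) := by
  have : Infinite Node := Infinite.of_injective (fun k => take (fun _ => 0) k)
    fun k l h => congrArg Sigma.fst h
  exact nonempty_equiv_of_countable

end OmegaCompactification

open OmegaCompactification in
theorem mainTheorem3 :
    (∃ (L : Type) (_ : TopologicalSpace L) (_ : CompactSpace L) (_ : T2Space L) (e : ℕ → L),
      IsDenseEmbedding e ∧
      ¬ TopologicalSpace.SeparableSpace (OmegaCompactification.growth e) ∧
      OmegaCompactification.SupportsMeasure (OmegaCompactification.growth e) ∧
      (OmegaCompactification.naturalCopy e).ClosedComplemented) ∧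
    (OmegaCompactification.additivity OmegaCompactification.nullIdeal =
        OmegaCompactification.uniformity OmegaCompactification.meagreIdeal →
      ∃ (L : Type) (_ : TopologicalSpace L) (_ : CompactSpace L) (_ : T2Space L) (e : ℕ → L),
        IsDenseEmbedding e ∧
        ¬ TopologicalSpace.SeparableSpace (OmegaCompactification.growth e) ∧
        OmegaCompactification.SupportsMeasure (OmegaCompactification.growth e) ∧
        (OmegaCompactification.naturalCopy e).ClosedComplemented ∧
        ¬ OmegaCompactification.MapsOntoCube (OmegaCompactification.growth e) ∧
        OmegaCompactification.HereditarilySeparablySobczyk C(L, ℝ)) := by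
  obtain ⟨q⟩ := nonempty_equiv_node
  refine ⟨?_, fun h => ?_⟩
  -- No chain is needed here: all thin slaloms together serve as the family, indexed by themselves.
  · let S : {S : Slalom // S.Thin} → Slalom := Subtype.val
    have hS : ∀ a, (S a).Thin := fun a => a.2
    have hH : Hitting (Set.range S) := by
      simp only [S, Subtype.range_coe_subtype]
      exact hitting_setOf_thin
    refine ⟨Space S, inferInstance, inferInstance, inferInstance, emb S ∘ q,
      isDenseEmbedding_emb q, ?_, ?_, closedComplemented_naturalCopy hS q⟩
    · rw [growth_emb_comp]; exact not_separableSpace_growth hS hH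
    · rw [growth_emb_comp]; exact supportsMeasure_growth hS q
  · obtain ⟨κ, _, _, S, hS, hmono, hH⟩ := exists_hitting_chain h
    have := seqCompactSpace_of_chain hmono
    refine ⟨Space S, inferInstance, inferInstance, inferInstance, emb S ∘ q,
      isDenseEmbedding_emb q, ?_, ?_, closedComplemented_naturalCopy hS q, ?_,
      hereditarilySeparablySobczyk_of_seqCompactSpace _⟩
    · rw [growth_emb_comp]; exact not_separableSpace_growth hS hH
    · rw [growth_emb_comp]; exact supportsMeasure_growth hS q
    · rw [growth_emb_comp]; exact not_mapsOntoCube_growth hmono
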